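/- **Setting.** For $L\in\mathbb N$, $L\ge 1$, let $\Omega_L=\mathbb Z^L$, $\|\phi\|_\infty=\max_k|\phi_k|$ and $H_L(\phi)=\sum_{k=1}^{L-1}|\phi_{k+1}-\phi_k|$. Let $(\mathbb Z^2)^*=(\tfrac12,\tfrac12)+\mathbb Z^2$ with its nearest-neighbour graph structure. The contour of $\phi$ is $$\Gamma(\phi)=\bigcup_{i=1}^{L}\{(x,\phi_i):x\in(i-1,i)\}\ \cup\ \bigcup_{i=1}^{L-1}\{(i,y):\phi_i\wedge\phi_{i+1}\le y\le\phi_i\vee\phi_{i+1}\},$$ and $\Delta(\phi)$ is the set of $p\in(\mathbb Z^2)^*$ whose Euclidean distance from $\Gamma(\phi)$ is $\frac12$ or $\frac1{\sqrt2}$. For $M>0$ put $V_L^M=\big([-\tfrac12,L+\tfrac12]\times[-(M+\tfrac12),M+\tfrac12]\big)\cap(\mathbb Z^2)^*$ and $V_L^\infty=\big([-\tfrac12,L+\tfrac12]\times\mathbb R\big)\cap(\mathbb Z^2)^*$. Let $\Phi(\beta,\Lambda)$ be a real potential, defined for finite $\Lambda\subset(\mathbb Z^2)^*$, and let $\bar\beta>0$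 and $m$ be such that $m(\beta)>0$ for $\beta>\bar\beta$, $m(\beta)\to+\infty$ as $\beta\to+\infty$, and, for every $\beta>\bar\beta$, (i) $\sum_{\Lambda\ni p,\ \mathrm{diam}\,\Lambda\ge k}|\Phi(\beta,\Lambda)|\le e^{-m(\beta)k}$ for all real $k>0$ and all $p\in(\mathbb Z^2)^*$, the sum being over finite connected $\Lambda$ (Euclidean diameter); (ii) $\Phi(\beta,\Lambda+v)=\Phi(\beta,\Lambda)$ for all $v\in\mathbb Z^2$. For $M\in(0,\infty]$ let $W_L^M(\beta,\phi)=\sum\Phi(\beta,\Lambda)$, the sum being over the finite connected $\Lambda\subset V_L^M$ with $\Lambda\cap\Delta(\phi)\ne\emptyset$. Let $\mu_L^M$ and $\bar\mu_L^M$ be the measures on $\Omega_L$ with point masses proportional to $$\mathbf 1(\|\phi\|_\infty\le M)\,e^{-\beta H_L(\phi)-W_L^M(\beta,\phi)}\quad\text{and}\quad \mathbf 1(|\phi_1|\le M)\,e^{-\beta H_L(\phi)-W_L^\infty(\beta,\phi)}$$ respectively, normalized to be probability measures (if the second weight has infinite total mass, $\bar\mu_L^M$ denotes the weight itself; only ratios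 of point masses are used below). Let $c_L^M(\phi,\psi)=(\mu_L^M(\psi)/\mu_L^M(\phi))^{1/2}$ if $\mu_L^M(\phi)>0$ and $\psi=\phi\pm\delta_k$ for some $k=1,\dots,L$ (i.e. $\psi$ is $\phi$ with the single coordinate $\phi_k$ replaced by $\phi_k\pm1$), and $c_L^M(\phi,\psi)=0$ otherwise; define $\bar c_L^M$ in the same way from $\bar\mu_L^M$. Let $$(G_L^Mf)(\phi)=\sum_\psi c_L^M(\phi,\psi)[f(\psi)-f(\phi)],\qquad(\bar G_L^Mf)(\phi)=\sum_\psi\bar c_L^M(\phi,\psi)[f(\psi)-f(\phi)].$$ For $\varepsilon\in(0,1/100)$ let $A=A_{L,\varepsilon}=\{\phi\in\Omega_L:\|\phi\|_\infty\le(1-\varepsilon)L/2\}$. **Proposition.** There are $K_1(\beta)>0$ and $K_2(\beta)>0$ ($\beta>\bar\beta$), with $K_2(\beta)\to+\infty$ as $\beta\to+\infty$, such that for every $\beta>\bar\beta$ and every $L\ge1$ one can construct a measurable space with probability measures $\mathbb P_{\phi,\bar\phi}$, $(\phi,\bar\phi)\in\Omega_L\times\Omega_L$, and on it a process $\{(\mathbf\Phi(t),\bar{\mathbf\Phi}(t)):t\ge0\}$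 with values in $\Omega_L\times\Omega_L$, such that for all $\phi,\bar\phi$ one has $\mathbb P_{\phi,\bar\phi}(\mathbf\Phi(0)=\phi,\ \bar{\mathbf\Phi}(0)=\bar\phi)=1$ and: 1. under $\mathbb P_{\phi,\bar\phi}$, $\mathbf\Phi$ and $\bar{\mathbf\Phi}$ are Markov processes (each with respect to its own past, with almost surely right-continuous paths having left limits) with generators $G_L^{L/2}$ and $\bar G_L^{L/2}$ respectively; 2. with $\sigma=\inf\{t\ge0:\mathbf\Phi(t)\ne\bar{\mathbf\Phi}(t)\}$ and $\bar\tau=\inf\{t\ge0:\bar{\mathbf\Phi}(t)\notin A_{L,\varepsilon}\}$ ($\inf\emptyset=\infty$), $$\mathbb P_{\phi,\phi}(\sigma\le t,\ \sigma\le\bar\tau)\le K_1(\beta)\,L\,t\,e^{-K_2(\beta)\,\varepsilon L}$$ for every $\varepsilon\in(0,1/100)$, every $\phi\in A_{L,\varepsilon}$ and every $t\ge0$. -/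

import Mathlib

open MeasureTheory ProbabilityTheory Filter Topology Set
open scoped NNReal ENNReal ProbabilityTheory

noncomputable section

namespace SOS

/-! ### Configurations and the dual lattice -/

/-- Height configurations `φ = (φ_1, …, φ_L) ∈ ℤ^L`; the `k`-th site (`k = 1, …, L`) has index `k - 1`.
The norm `‖φ‖` is the maximum of the `|φ_k|`. -/
abbrev Config (L : ℕ) : Type := Fin L → ℤ

/-- A pair of integers `(a, b)` stands for the site `(a + 1/2, b + 1/2)` of the dual lattice
`(1/2, 1/2) + ℤ²`, a point of the Euclidean plane. -/
def dualPoint (p : ℤ × ℤ) : EuclideanSpace ℝ (Fin 2) := !₂[(p.1 : ℝ) + 1 / 2, (p.2 : ℝ) + 1 / 2]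

/-- The nearest-neighbour graph on the dual lattice. -/
def dualGraph : SimpleGraph (ℤ × ℤ) where
  Adj p q := |p.1 - q.1| + |p.2 - q.2| = 1
  symm := ⟨fun p q h => by rw [abs_sub_comm q.1, abs_sub_comm q.2]; exact h⟩
  loopless := ⟨fun p h => by simp at h⟩

/-- Connectedness of a finite set of dual sites in the dual graph. -/
def IsConn (Λ : Finset (ℤ × ℤ)) : Prop := (dualGraph.induce (Λ : Set (ℤ × ℤ))).Connected

/-- Euclidean diameter of a finite set of dual sites. -/
def diam (Λ : Finset (ℤ × ℤ)) : ℝ := Metric.diam (dualPoint '' (Λ : Set (ℤ × ℤ)))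

/-! ### The potential -/

/-- The assumptions on the many-body potential `Φ(β, Λ)`, with decay rate `m(β)`, for `β > β₀`. -/
structure IsPotential (Φ : ℝ → Finset (ℤ × ℤ) → ℝ) (m : ℝ → ℝ) (β₀ : ℝ) : Prop where
  threshold_pos : 0 < β₀
  rate_pos : ∀ β > β₀, 0 < m β
  rate_tendsto : Tendsto m atTop atTop
  /-- `∑ |Φ(β, Λ)| ≤ exp (-m(β) k)`, the sum being over the connected `Λ ∋ p` with `diam Λ ≥ k`. -/
  decay : ∀ β > β₀, ∀ k : ℝ, 0 < k → ∀ p : ℤ × ℤ,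
    ∑' Λ : {Λ : Finset (ℤ × ℤ) // IsConn Λ ∧ p ∈ Λ ∧ k ≤ diam Λ}, ENNReal.ofReal |Φ β Λ|
      ≤ ENNReal.ofReal (Real.exp (-(m β * k)))
  /-- Invariance under lattice translations. -/
  translation : ∀ β > β₀, ∀ (v : ℤ × ℤ) (Λ : Finset (ℤ × ℤ)), Φ β (Λ.image (· + v)) = Φ β Λ

/-! ### Energy -/

/-- The local interaction `H_L(φ) = ∑_{k=1}^{L-1} |φ_{k+1} - φ_k|`. -/
def localEnergy {L : ℕ} (φ : Config L) : ℝ :=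
  ∑ i : Fin L, ∑ j : Fin L, if (j : ℕ) = i + 1 then |(φ j : ℝ) - φ i| else 0

/-- The contour `Γ(φ)`: open horizontal unit segments at the heights `φ_k`, over `(k - 1, k)`, and closed
vertical segments joining consecutive heights. -/
def contour {L : ℕ} (φ : Config L) : Set (EuclideanSpace ℝ (Fin 2)) :=
  {z | ∃ i : Fin L, z 0 ∈ Ioo ((i : ℕ) : ℝ) ((i : ℕ) + 1) ∧ z 1 = φ i} ∪
  {z | ∃ i j : Fin L, (j : ℕ) = i + 1 ∧ z 0 = ((j : ℕ) : ℝ) ∧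
    z 1 ∈ Icc (min (φ i : ℝ) (φ j)) (max (φ i : ℝ) (φ j))}

/-- The set `Δ(φ)` of the dual sites attached to the contour. -/
def attached {L : ℕ} (φ : Config L) : Set (ℤ × ℤ) :=
  {p | Metric.infDist (dualPoint p) (contour φ) = 1 / 2 ∨
    Metric.infDist (dualPoint p) (contour φ) = 1 / Real.sqrt 2}

/-- Dual sites in the infinite vertical strip `V_L^∞ = [-1/2, L + 1/2] × ℝ`. -/
def strip (L : ℕ) : Set (ℤ × ℤ) :=
  {p | dualPoint p 0 ∈ Icc (-(1 / 2) : ℝ) (L + 1 / 2)}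

/-- Dual sites in the box `V_L^M = [-1/2, L + 1/2] × [-(M + 1/2), M + 1/2]`. -/
def box (L : ℕ) (M : ℝ) : Set (ℤ × ℤ) :=
  {p ∈ strip L | dualPoint p 1 ∈ Icc (-(M + 1 / 2)) (M + 1 / 2)}

/-- The long range interaction: the sum of `Φ(β, Λ)` over the connected `Λ ⊆ V` that meet `Δ(φ)`.
It is `W_L^M` for `V = box L M` and `W_L^∞` for `V = strip L`. -/
def longRange {L : ℕ} (Φ : ℝ → Finset (ℤ × ℤ) → ℝ) (β : ℝ) (V : Set (ℤ × ℤ)) (φ : Config L) : ℝ :=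
  ∑' Λ : {Λ : Finset (ℤ × ℤ) //
    IsConn Λ ∧ (Λ : Set (ℤ × ℤ)) ⊆ V ∧ ((Λ : Set (ℤ × ℤ)) ∩ attached φ).Nonempty}, Φ β Λ

/-! ### Gibbs measures, jump rates, generators -/

open Classical in
/-- The weight `1(‖φ‖ ≤ M) exp (-β H_L(φ) - W_L^M(β, φ))`. -/
def weight {L : ℕ} (Φ : ℝ → Finset (ℤ × ℤ) → ℝ) (β M : ℝ) (φ : Config L) : ℝ :=
  if ‖φ‖ ≤ M then Real.exp (-(β * localEnergy φ) - longRange Φ β (box L M) φ) else 0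

open Classical in
/-- The weight `1(|φ_1| ≤ M) exp (-β H_L(φ) - W_L^∞(β, φ))` of the auxiliary model. -/
def auxWeight {L : ℕ} (Φ : ℝ → Finset (ℤ × ℤ) → ℝ) (β M : ℝ) (φ : Config L) : ℝ :=
  if ∀ i : Fin L, (i : ℕ) = 0 → |(φ i : ℝ)| ≤ M then
    Real.exp (-(β * localEnergy φ) - longRange Φ β (strip L) φ) else 0

open Classical in
/-- The partition function of a weight. If the weight is not summable it cannot be normalized, and we put
`1`, so that `gibbs` is then the weight itself. (The jump rates do not see the normalization.) -/
def partitionFunction {L : ℕ} (w : Config L → ℝ) : ℝ :=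
  if Summable w then ∑' φ, w φ else 1

/-- The (point masses of the) Gibbs measure with a given weight. -/
def gibbs {L : ℕ} (w : Config L → ℝ) (φ : Config L) : ℝ := w φ / partitionFunction w

/-- `ψ = φ ± δ_k` for some site `k`. -/
def IsMove {L : ℕ} (φ ψ : Config L) : Prop :=
  ∃ k : Fin L, ψ = φ + Pi.single k 1 ∨ ψ = φ - Pi.single k 1

open Classical in
/-- The jump rates `(μ(ψ) / μ(φ))^{1/2}` along the allowed moves. -/
def jumpRate {L : ℕ} (μ : Config L → ℝ) (φ ψ : Config L) : ℝ :=
  if 0 < μ φ ∧ IsMove φ ψ then Real.sqrt (μ ψ / μ φ) else 0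

/-- The generator `(G f)(φ) = ∑_ψ c(φ, ψ) (f(ψ) - f(φ))`; the sum has at most `2L` nonzero terms. -/
def generator {L : ℕ} (μ : Config L → ℝ) (f : Config L → ℝ) (φ : Config L) : ℝ :=
  ∑' ψ : Config L, jumpRate μ φ ψ * (f ψ - f φ)

/-- The generator `G_L^M` of the interface dynamics. -/
def G (Φ : ℝ → Finset (ℤ × ℤ) → ℝ) (β : ℝ) (L : ℕ) (M : ℝ) : (Config L → ℝ) → Config L → ℝ :=
  generator (gibbs (weight Φ β M))

/-- The generator `Ḡ_L^M` of the auxiliary dynamics. -/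
def Gbar (Φ : ℝ → Finset (ℤ × ℤ) → ℝ) (β : ℝ) (L : ℕ) (M : ℝ) : (Config L → ℝ) → Config L → ℝ :=
  generator (gibbs (auxWeight Φ β M))

/-! ### Markov processes in continuous time -/

/-- A Markov transition semigroup whose derivative at time `0`, on bounded functions, is `A`. -/
structure IsMarkovSemigroup {S : Type} [MeasurableSpace S] (A : (S → ℝ) → S → ℝ)
    (Q : ℝ≥0 → Kernel S S) : Prop where
  markov : ∀ t, IsMarkovKernel (Q t)
  zero : Q 0 = Kernel.id
  add : ∀ s t, Q (s + t) = Q t ∘ₖ Q s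
  generator : ∀ f : S → ℝ, Measurable f → (∃ C, ∀ x, |f x| ≤ C) → ∀ x,
    Tendsto (fun h : ℝ≥0 => ((∫ y, f y ∂(Q h x)) - f x) / (h : ℝ)) (𝓝[>] 0) (𝓝 (A f x))

/-- The `σ`-algebra of the past up to time `s`. -/
abbrev past {Ω S : Type} [MeasurableSpace S] (X : ℝ≥0 → Ω → S) (s : ℝ≥0) : MeasurableSpace Ω :=
  ⨆ u : ℝ≥0, ⨆ _ : u ≤ s, MeasurableSpace.comap (X u) inferInstance

/-- `X` is, under `P`, a Markov process with generator `A`: almost surely the paths are right-continuous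
with left limits, and the conditional law of `X (s + t)` given the past up to time `s` is `Q t (X s)`,
where `Q` is a Markov semigroup with generator `A`. -/
structure IsMarkovProcess {Ω S : Type} [MeasurableSpace Ω] [MeasurableSpace S] [TopologicalSpace S]
    (A : (S → ℝ) → S → ℝ) (X : ℝ≥0 → Ω → S) (P : Measure Ω) : Prop where
  measurable : ∀ t, Measurable (X t)
  right_continuous : ∀ᵐ ω ∂P, ∀ t, ContinuousWithinAt (fun u => X u ω) (Ici t) t
  left_limits : ∀ᵐ ω ∂P, ∀ t, ∃ x, Tendsto (fun u => X u ω) (𝓝[<] t) (𝓝 x)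
  markov : ∃ Q : ℝ≥0 → Kernel S S, IsMarkovSemigroup A Q ∧
    ∀ s t : ℝ≥0, ∀ B : Set S, MeasurableSet B →
      P⟦X (s + t) ⁻¹' B | past X s⟧ =ᵐ[P] fun ω => (Q t (X s ω)).real B

/-- The decoupling time `σ = inf {t ≥ 0 : X t ≠ Y t}`, with value `∞` if there is no such `t`. -/
def decouplingTime {Ω S : Type} (X Y : ℝ≥0 → Ω → S) (ω : Ω) : ℝ≥0∞ :=
  ⨅ (t : ℝ≥0) (_ : X t ω ≠ Y t ω), (t : ℝ≥0∞)

/-- The first exit time `inf {t ≥ 0 : Y t ∉ A}` from `A`, with value `∞` if there is no such `t`. -/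
def exitTime {Ω S : Type} (A : Set S) (Y : ℝ≥0 → Ω → S) (ω : Ω) : ℝ≥0∞ :=
  ⨅ (t : ℝ≥0) (_ : Y t ω ∉ A), (t : ℝ≥0∞)

/-- The region `A = {φ : ‖φ‖ ≤ (1 - ε) L / 2}`. -/
def region (L : ℕ) (ε : ℝ) : Set (Config L) := {φ | ‖φ‖ ≤ (1 - ε) * L / 2}

end SOS

end

/-!
The two dynamics are built on one probability space from one sequence of independent pairs, an
exponential waiting time and a mark. A mark proposes one of the `2L` moves `±δ_k`, uniformly, with a
uniform threshold `v ∈ [0, 1]`; a process with rates `c ≤ R` accepts the move if `v ≤ c / R`, and the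
proposals come at rate `2LR`. Each process is then, by itself, a Markov process with the right
generator (`isMarkovProcess_jumpProcess`, `generator_eq_integral_markLaw`). The Markov property is
proved by conditioning on the first jump, with an induction on the number of jumps before the time
considered (`noiseLaw_cylinder_inter`); explosions are excluded by the renewal bound
`tsum_noiseLaw_jumpTime_le` on the mean number of jumps.

Two such processes that agree at `φ` are separated by the next mark only if its threshold falls
between the two rates divided by `R`. As the mean number of marks before time `t` is `2LRt`, two
dynamics with rates that differ by at most `δ` in a region separate inside that region before time
`t` with probability at most `2Lδt` (`noiseLaw_decouplingTime_le`, `exists_coupling`).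

It remains to compare the rates (`abs_jumpRate_sub_le`). A move at the site `k` changes the set of
dual sites attached to the contour only at twelve sites near `(k, φ_k)`
(`mem_attached_add_move_iff`), hence changes the interaction by at most a constant that depends on
`β` alone: the one-point sets have the same potential by translation invariance, and the other
sets have diameter at least `1`. So all rates are bounded in terms of `β`. For `φ` in the region, the
rates of the two dynamics differ only through the sets `Λ` that contain one of the twelve sites and
leave the box; their diameter is at least `εL/2 - 1`, and the decay of the potential makes their
contribution of order `exp (-m(β) εL / 4)` when `εL ≥ 4`. When `εL < 4` the bound on the rates
suffices. This gives `K₂ = m / 4`.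
-/

noncomputable section

namespace SOS

/-! ### Independent sequences and exponential holding times -/

/-- The sequence `w, ω 0, ω 1, …`. -/
def consSeq {W : Type*} (w : W) (ω : ℕ → W) : ℕ → W
  | 0 => w
  | n + 1 => ω n

/-- The sequence `ω 1, ω 2, …`. -/
def shift {W : Type*} (ω : ℕ → W) : ℕ → W := fun n => ω (n + 1)

@[simp] lemma consSeq_zero {W : Type*} (w : W) (ω : ℕ → W) : consSeq w ω 0 = w := rfl

@[simp] lemma consSeq_succ {W : Type*} (w : W) (ω : ℕ → W) (n : ℕ) :
    consSeq w ω (n + 1) = ω n := rfl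

@[simp] lemma shift_consSeq {W : Type*} (w : W) (ω : ℕ → W) : shift (consSeq w ω) = ω := rfl

lemma measurable_consSeq {W : Type*} [MeasurableSpace W] :
    Measurable fun p : W × (ℕ → W) => consSeq p.1 p.2 := by
  refine measurable_pi_iff.2 fun n => ?_
  cases n with
  | zero => exact measurable_fst
  | succ n => exact (measurable_pi_apply n).comp measurable_snd

lemma measurable_shift {W : Type*} [MeasurableSpace W] :
    Measurable (shift : (ℕ → W) → ℕ → W) :=
  measurable_pi_iff.2 fun n => measurable_pi_apply (n + 1)

/-- The law of an independent sequence with marginals `μ`. -/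
abbrev iidLaw {W : Type*} [MeasurableSpace W] (μ : Measure W) [IsProbabilityMeasure μ] :
    Measure (ℕ → W) :=
  Measure.infinitePi fun _ : ℕ => μ

section Iid

variable {W : Type*} [MeasurableSpace W] (μ : Measure W) [IsProbabilityMeasure μ]

lemma map_consSeq_prod_iidLaw :
    (μ.prod (iidLaw μ)).map (fun p : W × (ℕ → W) => consSeq p.1 p.2) = iidLaw μ := by
  classical
  refine Measure.eq_infinitePi _ fun s t ht => ?_
  -- a box over `s` as a box over an initial segment, with trivial sides off `s`
  set t' : ℕ → Set W := fun i => if i ∈ s then t i else univ with ht'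
  have mt' : ∀ i, MeasurableSet (t' i) := fun i => by
    simp only [ht']; split_ifs; exacts [ht i, .univ]
  obtain ⟨N, hN⟩ : ∃ N, s ⊆ Finset.range (N + 1) :=
    ⟨s.sup id, fun i hi => Finset.mem_range.2 (Nat.lt_succ_of_le (Finset.le_sup (f := id) hi))⟩
  have hpre : (fun p : W × (ℕ → W) => consSeq p.1 p.2) ⁻¹' (Set.pi s t)
      = t' 0 ×ˢ Set.pi (Finset.range N) fun i => t' (i + 1) := by
    ext ⟨w, ω⟩
    simp only [mem_preimage, Set.mem_pi, mem_prod, Finset.mem_coe, Finset.mem_range, ht']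
    constructor
    · intro h
      refine ⟨?_, fun i _ => ?_⟩
      · split_ifs with h0
        · exact h 0 h0
        · trivial
      · split_ifs with h0
        · exact h (i + 1) h0
        · trivial
    · rintro ⟨h0, h1⟩ i hi
      cases i with
      | zero => simpa [hi] using h0
      | succ i =>
        have := h1 i (by have := Finset.mem_range.1 (hN hi); omega)
        simpa [hi] using this
  have hm : MeasurableSet (Set.pi (s : Set ℕ) t) :=
    MeasurableSet.pi s.countable_toSet fun i _ => ht i
  rw [Measure.map_apply measurable_consSeq hm, hpre, Measure.prod_prod,
    Measure.infinitePi_pi _ fun i _ => mt' (i + 1)]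
  have hprod : ∏ i ∈ s, μ (t i) = ∏ i ∈ Finset.range (N + 1), μ (t' i) := by
    rw [← Finset.prod_subset hN]
    · exact Finset.prod_congr rfl fun i hi => by simp [ht', hi]
    · intro i _ hi
      simp [ht', hi]
  rw [hprod, Finset.prod_range_succ', mul_comm]

/-- Conditioning on the first term of an independent sequence. -/
lemma lintegral_iidLaw {F : (ℕ → W) → ℝ≥0∞} (hF : Measurable F) :
    ∫⁻ ω, F ω ∂(iidLaw μ) = ∫⁻ w, ∫⁻ ω, F (consSeq w ω) ∂(iidLaw μ) ∂μ := by
  conv_lhs => rw [← map_consSeq_prod_iidLaw μ]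
  rw [lintegral_map hF measurable_consSeq]
  exact lintegral_prod _ (hF.comp measurable_consSeq).aemeasurable

end Iid

/-- The exponential law of rate `r`, as a measure on `ℝ≥0`. -/
def holdingLaw (r : ℝ) : Measure ℝ≥0 := (expMeasure r).map Real.toNNReal

lemma isProbabilityMeasure_holdingLaw {r : ℝ} (hr : 0 < r) :
    IsProbabilityMeasure (holdingLaw r) :=
  haveI := isProbabilityMeasure_expMeasure hr
  Measure.isProbabilityMeasure_map measurable_real_toNNReal.aemeasurable

lemma expMeasure_eq_withDensity (r : ℝ) :
    expMeasure r = volume.withDensity (exponentialPDF r) := rfl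

lemma measurable_exponentialPDF (r : ℝ) : Measurable (exponentialPDF r) :=
  (measurable_exponentialPDFReal r).ennreal_ofReal

lemma holdingLaw_Iic {r : ℝ} (hr : 0 < r) (s : ℝ≥0) :
    holdingLaw r (Iic s) = ENNReal.ofReal (1 - Real.exp (-(r * s))) := by
  have hpre : Real.toNNReal ⁻¹' (Iic s) = Iic (s : ℝ) := by
    ext x; simp [Real.toNNReal_le_iff_le_coe]
  rw [holdingLaw, Measure.map_apply measurable_real_toNNReal measurableSet_Iic, hpre,
    expMeasure_eq_withDensity, withDensity_apply _ measurableSet_Iic,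
    lintegral_exponentialPDF_eq_antiDeriv hr, if_pos s.coe_nonneg]

lemma holdingLaw_Ioi {r : ℝ} (hr : 0 < r) (s : ℝ≥0) :
    holdingLaw r (Ioi s) = ENNReal.ofReal (Real.exp (-(r * s))) := by
  have := isProbabilityMeasure_holdingLaw hr
  rw [← compl_Iic, prob_compl_eq_one_sub measurableSet_Iic, holdingLaw_Iic hr,
    ← ENNReal.ofReal_one, ← ENNReal.ofReal_sub _ (by
      rw [sub_nonneg, Real.exp_le_one_iff]
      have := mul_nonneg hr.le s.2
      simpa using this)]
  congr 1; ring

/-- The exponential law has no memory. -/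
lemma lintegral_holdingLaw_sub {r : ℝ} (hr : 0 < r) (s : ℝ≥0) {g : ℝ≥0 → ℝ≥0∞}
    (hg : Measurable g) :
    ∫⁻ x in Ioi s, g (x - s) ∂(holdingLaw r)
      = holdingLaw r (Ioi s) * ∫⁻ x, g x ∂(holdingLaw r) := by
  have := isProbabilityMeasure_holdingLaw hr
  have hsub : Measurable fun x : ℝ≥0 => x - s := measurable_id.sub_const s
  have key : ((holdingLaw r).restrict (Ioi s)).map (fun x => x - s)
      = holdingLaw r (Ioi s) • holdingLaw r := by
    -- finite measures on `ℝ≥0` are determined by their total mass and their tails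
    refine ext_of_generate_finite (range Ioi)
      (BorelSpace.measurable_eq.trans (borel_eq_generateFrom_Ioi _)) isPiSystem_Ioi ?_ ?_
    · rintro _ ⟨a, rfl⟩
      have hpre : (fun x : ℝ≥0 => x - s) ⁻¹' (Ioi a) ∩ Ioi s = Ioi (a + s) := by
        ext x
        simp only [mem_inter_iff, mem_preimage, mem_Ioi, lt_tsub_iff_right]
        exact ⟨fun h => h.1, fun h => ⟨h, lt_of_le_of_lt le_add_self h⟩⟩
      rw [Measure.map_apply hsub measurableSet_Ioi, Measure.restrict_apply
        (hsub measurableSet_Ioi), hpre, Measure.smul_apply, smul_eq_mul, holdingLaw_Ioi hr,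
        holdingLaw_Ioi hr, holdingLaw_Ioi hr, ← ENNReal.ofReal_mul (Real.exp_nonneg _),
        ← Real.exp_add]
      congr 2; push_cast; ring
    · rw [Measure.map_apply hsub .univ]
      simp
  rw [← lintegral_map (μ := (holdingLaw r).restrict (Ioi s)) hg hsub, key, lintegral_smul_measure,
    smul_eq_mul]

/-- The function `t ↦ r t` (the mean number of jumps up to time `t`) solves the renewal equation
of the exponential law of rate `r`. -/
lemma lintegral_holdingLaw_renewal {r : ℝ} (hr : 0 < r) (t : ℝ≥0) :
    ∫⁻ x in Iic t, (1 + ENNReal.ofReal (r * (t - x : ℝ≥0))) ∂(holdingLaw r)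
      = ENNReal.ofReal (r * t) := by
  have hmeas : Measurable fun x : ℝ≥0 => 1 + ENNReal.ofReal (r * (t - x : ℝ≥0)) := by fun_prop
  have hpre : Real.toNNReal ⁻¹' (Iic t) = Iic (t : ℝ) := by
    ext x; simp [Real.toNNReal_le_iff_le_coe]
  have hderiv : ∀ x : ℝ, HasDerivAt (fun x : ℝ => -(r * (t - x)) * Real.exp (-(r * x)))
      (r * Real.exp (-(r * x)) * (1 + r * (t - x))) x := by
    intro x
    have h1 : HasDerivAt (fun x : ℝ => -(r * (t - x))) r x := by
      exact ((((hasDerivAt_id x).const_sub (t : ℝ)).const_mul r).neg).congr_deriv (by ring)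
    have h2 : HasDerivAt (fun x : ℝ => Real.exp (-(r * x))) (Real.exp (-(r * x)) * (-r)) x := by
      exact ((((hasDerivAt_id x).const_mul r).neg).exp).congr_deriv (by simp)
    exact (h1.mul h2).congr_deriv (by ring)
  have hcont : Continuous fun x : ℝ => r * Real.exp (-(r * x)) * (1 + r * (t - x)) := by fun_prop
  have hint : ∫ x in (0 : ℝ)..t, r * Real.exp (-(r * x)) * (1 + r * (t - x)) = r * t := by
    rw [intervalIntegral.integral_eq_sub_of_hasDerivAt (fun x _ => hderiv x)
      (hcont.intervalIntegrable _ _)]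
    simp
  rw [holdingLaw, setLIntegral_map measurableSet_Iic hmeas measurable_real_toNNReal, hpre,
    expMeasure_eq_withDensity]
  refine (setLIntegral_withDensity_eq_setLIntegral_mul _ (measurable_exponentialPDF r)
    (hmeas.comp measurable_real_toNNReal) measurableSet_Iic).trans ?_
  rw [← hint, intervalIntegral.integral_of_le t.coe_nonneg]
  have hsplit : Iic (t : ℝ) = Iio 0 ∪ Icc 0 (t : ℝ) := (Iio_union_Icc_eq_Iic t.2).symm
  rw [hsplit, lintegral_union measurableSet_Icc
    (by rw [Set.disjoint_left]; intro x hx hx'; exact absurd hx'.1 (not_le.2 hx))]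
  have hz : ∫⁻ x in Iio (0 : ℝ), (exponentialPDF r * ((fun x : ℝ≥0 =>
      1 + ENNReal.ofReal (r * (t - x : ℝ≥0))) ∘ Real.toNNReal)) x = 0 := by
    rw [setLIntegral_congr_fun measurableSet_Iio (g := fun _ => 0), lintegral_zero]
    intro x hx
    simp [exponentialPDF_of_neg hx]
  have hnn : ∀ x ∈ Icc (0 : ℝ) t, 0 ≤ r * Real.exp (-(r * x)) * (1 + r * (t - x)) := by
    intro x hx
    have h1 : 0 ≤ (t : ℝ) - x := sub_nonneg.2 hx.2
    positivity
  have hc : ∫⁻ x in Icc 0 (t : ℝ), (exponentialPDF r * ((fun x : ℝ≥0 =>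
      1 + ENNReal.ofReal (r * (t - x : ℝ≥0))) ∘ Real.toNNReal)) x
      = ∫⁻ x in Icc 0 (t : ℝ), ENNReal.ofReal (r * Real.exp (-(r * x)) * (1 + r * (t - x))) := by
    refine setLIntegral_congr_fun measurableSet_Icc fun x hx => ?_
    have h1 : 0 ≤ (t : ℝ) - x := sub_nonneg.2 hx.2
    have h2 : ((t - Real.toNNReal x : ℝ≥0) : ℝ) = t - x := by
      rw [NNReal.coe_sub (Real.toNNReal_le_iff_le_coe.2 hx.2), Real.coe_toNNReal _ hx.1]
    simp only [Pi.mul_apply, Function.comp, exponentialPDF_of_nonneg hx.1, h2]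
    rw [ENNReal.ofReal_mul (p := r * Real.exp (-(r * x))) (by positivity),
      ENNReal.ofReal_add zero_le_one (by positivity),
      ENNReal.ofReal_one]
  rw [hz, zero_add, hc, ← integral_Icc_eq_integral_Ioc, ofReal_integral_eq_lintegral_ofReal]
  · exact hcont.continuousOn.integrableOn_compact isCompact_Icc
  · exact (ae_restrict_iff' measurableSet_Icc).2 (Eventually.of_forall hnn)

/-! ### Jump processes driven by independent marks -/

section JumpProcess

variable {S U : Type*}

/-- The time of the `n`-th jump, when `(ω i).1` is the waiting time between the jumps `i` and
`i + 1`; `jumpTime ω 0 = 0`. -/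
def jumpTime (ω : ℕ → ℝ≥0 × U) (n : ℕ) : ℝ≥0 := ∑ i ∈ Finset.range n, (ω i).1

/-- The state after `n` jumps: the jump `i + 1` takes `x` to `f x (ω i).2`. The recursion is on the
first jump. -/
def chain (f : S → U → S) : ℕ → S → (ℕ → ℝ≥0 × U) → S
  | 0, x, _ => x
  | n + 1, x, ω => chain f n (f x (ω 0).2) (shift ω)

open Classical in
/-- The right-continuous jump process with jump times `jumpTime ω` and successive states
`chain f n x ω`; it has a fixed value after an explosion. -/
def jumpProcess [Inhabited S] (f : S → U → S) (x : S) (t : ℝ≥0) (ω : ℕ → ℝ≥0 × U) : S :=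
  if h : ∃ n, t < jumpTime ω (n + 1) then chain f (Nat.find h) x ω else default

@[simp] lemma jumpTime_zero (ω : ℕ → ℝ≥0 × U) : jumpTime ω 0 = 0 := by simp [jumpTime]

lemma jumpTime_succ (ω : ℕ → ℝ≥0 × U) (n : ℕ) :
    jumpTime ω (n + 1) = jumpTime ω n + (ω n).1 := Finset.sum_range_succ _ _

lemma jumpTime_consSeq (w : ℝ≥0 × U) (ω : ℕ → ℝ≥0 × U) (n : ℕ) :
    jumpTime (consSeq w ω) (n + 1) = w.1 + jumpTime ω n := by
  simp [jumpTime, Finset.sum_range_succ', add_comm]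

lemma monotone_jumpTime (ω : ℕ → ℝ≥0 × U) : Monotone (jumpTime ω) :=
  monotone_nat_of_le_succ fun n => by rw [jumpTime_succ]; exact le_self_add

lemma chain_succ (f : S → U → S) (n : ℕ) (x : S) (ω : ℕ → ℝ≥0 × U) :
    chain f (n + 1) x ω = f (chain f n x ω) (ω n).2 := by
  induction n generalizing x ω with
  | zero => rfl
  | succ n ih => exact ih (f x (ω 0).2) (shift ω)

lemma exists_jumpTime_or_forall_le (ω : ℕ → ℝ≥0 × U) (t : ℝ≥0) :
    (∃ n, jumpTime ω n ≤ t ∧ t < jumpTime ω (n + 1)) ∨ ∀ n, jumpTime ω n ≤ t := by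
  by_cases h : ∃ n, t < jumpTime ω n
  · classical
    left
    have hpos : Nat.find h ≠ 0 := fun h0 => by
      have := Nat.find_spec h
      rw [h0, jumpTime_zero] at this
      exact not_lt_zero this
    obtain ⟨k, hk⟩ := Nat.exists_eq_succ_of_ne_zero hpos
    refine ⟨k, not_lt.1 (Nat.find_min h (by omega)), ?_⟩
    have := Nat.find_spec h
    rwa [hk] at this
  · right
    push Not at h
    exact h

variable [Inhabited S]

lemma jumpProcess_eq (f : S → U → S) (x : S) {t : ℝ≥0} {ω : ℕ → ℝ≥0 × U} {n : ℕ}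
    (h₁ : jumpTime ω n ≤ t) (h₂ : t < jumpTime ω (n + 1)) :
    jumpProcess f x t ω = chain f n x ω := by
  classical
  have h : ∃ n, t < jumpTime ω (n + 1) := ⟨n, h₂⟩
  have hn : Nat.find h = n := (Nat.find_eq_iff h).2
    ⟨h₂, fun k hk => not_lt.2 ((monotone_jumpTime ω (Nat.succ_le_of_lt hk)).trans h₁)⟩
  rw [jumpProcess, dif_pos h]
  convert rfl using 2
  exact hn.symm

lemma jumpProcess_of_forall_le (f : S → U → S) (x : S) {t : ℝ≥0} {ω : ℕ → ℝ≥0 × U}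
    (h : ∀ n, jumpTime ω n ≤ t) : jumpProcess f x t ω = default := by
  classical
  rw [jumpProcess, dif_neg]
  rintro ⟨n, hn⟩
  exact absurd (h (n + 1)) (not_le.2 hn)

lemma jumpProcess_consSeq_of_lt (f : S → U → S) (x : S) {t : ℝ≥0} {w : ℝ≥0 × U}
    (ω : ℕ → ℝ≥0 × U) (h : t < w.1) : jumpProcess f x t (consSeq w ω) = x :=
  jumpProcess_eq (n := 0) f x (by simp) (by simpa [jumpTime_consSeq] using h)

lemma jumpProcess_consSeq_of_le (f : S → U → S) (x : S) {t : ℝ≥0} {w : ℝ≥0 × U}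
    (ω : ℕ → ℝ≥0 × U) (h : w.1 ≤ t) :
    jumpProcess f x t (consSeq w ω) = jumpProcess f (f x w.2) (t - w.1) ω := by
  rcases exists_jumpTime_or_forall_le ω (t - w.1) with ⟨n, h₁, h₂⟩ | h'
  · rw [jumpProcess_eq f _ h₁ h₂, jumpProcess_eq (n := n + 1) f x]
    · rfl
    · rw [jumpTime_consSeq]
      exact (add_le_add_right h₁ _).trans_eq (add_tsub_cancel_of_le h)
    · rw [jumpTime_consSeq]
      exact (tsub_lt_iff_left h).1 h₂
  · rw [jumpProcess_of_forall_le f _ h', jumpProcess_of_forall_le f x]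
    intro n
    refine (monotone_jumpTime _ n.le_succ).trans ?_
    rw [Nat.succ_eq_add_one, jumpTime_consSeq]
    exact (add_le_add_right (h' n) _).trans_eq (add_tsub_cancel_of_le h)

end JumpProcess

section Measurability

variable {S U : Type*} [MeasurableSpace U]

lemma measurable_jumpTime (n : ℕ) :
    Measurable fun ω : ℕ → ℝ≥0 × U => jumpTime ω n := by
  unfold jumpTime
  fun_prop

variable [MeasurableSpace S] [Countable S] [DiscreteMeasurableSpace S]
  {f : S → U → S} (hf : ∀ x, Measurable (f x))
include hf

lemma measurable_chain (n : ℕ) (x : S) : Measurable (chain f n x) := by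
  induction n generalizing x with
  | zero => exact measurable_const
  | succ n ih =>
    have h : Measurable fun p : S × (ℕ → ℝ≥0 × U) => chain f n p.1 p.2 :=
      measurable_from_prod_countable_right fun y => ih y
    exact h.comp (((hf x).comp (measurable_snd.comp (measurable_pi_apply 0))).prodMk
      measurable_shift)

lemma measurable_jumpProcess [Inhabited S] (x : S) (t : ℝ≥0) :
    Measurable (jumpProcess f x t) := by
  refine measurable_to_countable' fun y => ?_
  have : jumpProcess f x t ⁻¹' {y}
      = (⋃ n, ({ω | jumpTime ω n ≤ t} ∩ {ω | t < jumpTime ω (n + 1)}) ∩ chain f n x ⁻¹' {y}) ∪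
        ((⋂ n, {ω | jumpTime ω n ≤ t}) ∩ {_ω | default = y}) := by
    ext ω
    simp only [mem_preimage, mem_singleton_iff, mem_union, mem_iUnion, mem_inter_iff,
      mem_ofPred_eq, mem_iInter]
    rcases exists_jumpTime_or_forall_le ω t with ⟨n, h₁, h₂⟩ | h'
    · rw [jumpProcess_eq f x h₁ h₂]
      constructor
      · exact fun h => Or.inl ⟨n, ⟨h₁, h₂⟩, h⟩
      · rintro (⟨k, ⟨h₃, h₄⟩, h₅⟩ | ⟨h, -⟩)
        · rw [← jumpProcess_eq f x h₁ h₂, jumpProcess_eq f x h₃ h₄, h₅]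
        · exact absurd (h (n + 1)) (not_le.2 h₂)
    · rw [jumpProcess_of_forall_le f x h']
      constructor
      · exact fun h => Or.inr ⟨h', h⟩
      · rintro (⟨k, ⟨_, h₄⟩, _⟩ | ⟨_, h⟩)
        · exact absurd (h' (k + 1)) (not_le.2 h₄)
        · exact h
  rw [this]
  refine (MeasurableSet.iUnion fun n => ?_).union (MeasurableSet.inter ?_ (.const _))
  · exact ((measurable_jumpTime n measurableSet_Iic).inter
      (measurable_jumpTime (n + 1) measurableSet_Ioi)).inter
        (measurable_chain hf n x (measurableSet_singleton y))
  · exact MeasurableSet.iInter fun n => measurable_jumpTime n measurableSet_Iic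

end Measurability

/-! ### The driving noise -/

section Noise

variable {U : Type*} [MeasurableSpace U] (r : ℝ) [hr : Fact (0 < r)]
  (ν : Measure U) [IsProbabilityMeasure ν]

instance : IsProbabilityMeasure (holdingLaw r) := isProbabilityMeasure_holdingLaw hr.out

/-- The law of an independent sequence of pairs: an exponential holding time of rate `r`, and an
independent mark with law `ν`. -/
abbrev noiseLaw : Measure (ℕ → ℝ≥0 × U) := iidLaw ((holdingLaw r).prod ν)

/-- Conditioning on the first holding time and the first mark. -/
lemma lintegral_noiseLaw {F : (ℕ → ℝ≥0 × U) → ℝ≥0∞} (hF : Measurable F) :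
    ∫⁻ ω, F ω ∂(noiseLaw r ν)
      = ∫⁻ a, ∫⁻ u, ∫⁻ ω, F (consSeq (a, u) ω) ∂(noiseLaw r ν) ∂ν ∂(holdingLaw r) := by
  rw [lintegral_iidLaw _ hF]
  exact lintegral_prod _
    (Measurable.lintegral_prod_right' (hF.comp measurable_consSeq)).aemeasurable

lemma noiseLaw_apply {C : Set (ℕ → ℝ≥0 × U)} (hC : MeasurableSet C) :
    noiseLaw r ν C
      = ∫⁻ a, ∫⁻ u, noiseLaw r ν {ω | consSeq (a, u) ω ∈ C} ∂ν ∂(holdingLaw r) := by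
  rw [← lintegral_indicator_one hC, lintegral_noiseLaw r ν (measurable_one.indicator hC)]
  refine lintegral_congr fun a => lintegral_congr fun u => ?_
  have hm : MeasurableSet {ω | consSeq (a, u) ω ∈ C} :=
    (measurable_consSeq.comp measurable_prodMk_left) hC
  rw [← lintegral_indicator_one hm]
  rfl

lemma setLIntegral_noiseLaw {C : Set (ℕ → ℝ≥0 × U)} (hC : MeasurableSet C)
    {F : (ℕ → ℝ≥0 × U) → ℝ≥0∞} (hF : Measurable F) :
    ∫⁻ ω in C, F ω ∂(noiseLaw r ν)
      = ∫⁻ a, ∫⁻ u, ∫⁻ ω in {ω | consSeq (a, u) ω ∈ C}, F (consSeq (a, u) ω)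
          ∂(noiseLaw r ν) ∂ν ∂(holdingLaw r) := by
  rw [← lintegral_indicator hC, lintegral_noiseLaw r ν (hF.indicator hC)]
  refine lintegral_congr fun a => lintegral_congr fun u => ?_
  have hm : MeasurableSet {ω | consSeq (a, u) ω ∈ C} :=
    (measurable_consSeq.comp measurable_prodMk_left) hC
  rw [← lintegral_indicator hm]
  rfl

/-- The renewal equation for the jump times. -/
lemma noiseLaw_jumpTime_succ_le (n : ℕ) (t : ℝ≥0) :
    noiseLaw r ν {ω | jumpTime ω (n + 1) ≤ t}
      = ∫⁻ a in Iic t, noiseLaw r ν {ω | jumpTime ω n ≤ t - a} ∂(holdingLaw r) := by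
  have hC : MeasurableSet {ω : ℕ → ℝ≥0 × U | jumpTime ω (n + 1) ≤ t} :=
    measurable_jumpTime (n + 1) measurableSet_Iic
  rw [noiseLaw_apply r ν hC, ← lintegral_indicator measurableSet_Iic]
  refine lintegral_congr fun a => ?_
  by_cases h : a ≤ t
  · rw [indicator_of_mem (by exact h)]
    have : ∀ u : U, {ω | consSeq (a, u) ω ∈ {ω : ℕ → ℝ≥0 × U | jumpTime ω (n + 1) ≤ t}}
        = {ω | jumpTime ω n ≤ t - a} := fun u => by
      ext ω
      simp only [mem_ofPred_eq, jumpTime_consSeq]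
      exact (le_tsub_iff_left h).symm
    simp only [this, lintegral_const, measure_univ, mul_one]
  · rw [indicator_of_notMem (by exact h)]
    have : ∀ u : U, {ω | consSeq (a, u) ω ∈ {ω : ℕ → ℝ≥0 × U | jumpTime ω (n + 1) ≤ t}}
        = ∅ := fun u => by
      ext ω
      simp only [mem_ofPred_eq, jumpTime_consSeq, mem_empty_iff_false, iff_false]
      exact fun h' => h (le_self_add.trans h')
    simp only [this, lintegral_const, measure_univ, mul_one, measure_empty]

/-- The mean number of jumps up to time `t` is at most `r t`. -/
lemma tsum_noiseLaw_jumpTime_le (t : ℝ≥0) :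
    ∑' n, noiseLaw r ν {ω | jumpTime ω (n + 1) ≤ t} ≤ ENNReal.ofReal (r * t) := by
  refine ENNReal.tsum_le_of_sum_range_le fun N => ?_
  induction N generalizing t with
  | zero => simp
  | succ N ih =>
    have hm : ∀ n, Measurable fun a : ℝ≥0 =>
        noiseLaw r ν {ω : ℕ → ℝ≥0 × U | jumpTime ω n ≤ t - a} := fun n => by
      have hanti : Antitone fun a : ℝ≥0 =>
          noiseLaw r ν {ω : ℕ → ℝ≥0 × U | jumpTime ω n ≤ t - a} := fun a b hab =>
        measure_mono fun ω (hω : jumpTime ω n ≤ t - b) => hω.trans (tsub_le_tsub_left hab t)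
      exact hanti.measurable
    simp_rw [noiseLaw_jumpTime_succ_le]
    rw [← lintegral_finsetSum _ fun n _ => hm n, ← lintegral_holdingLaw_renewal hr.out]
    refine lintegral_mono fun a => ?_
    rw [Finset.sum_range_succ', add_comm]
    refine add_le_add prob_le_one (ih (t - a))

lemma ae_exists_lt_jumpTime :
    ∀ᵐ ω ∂(noiseLaw r ν), ∀ t : ℝ≥0, ∃ n, t < jumpTime ω n := by
  have h : ∀ k : ℕ, ∀ᵐ ω ∂(noiseLaw r ν), ∃ n, (k : ℝ≥0) < jumpTime ω n := fun k => by
    have h0 := measure_limsup_atTop_eq_zero (μ := noiseLaw r ν)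
      (s := fun n => {ω : ℕ → ℝ≥0 × U | jumpTime ω (n + 1) ≤ k})
      ((tsum_noiseLaw_jumpTime_le r ν k).trans_lt ENNReal.ofReal_lt_top).ne
    refine measure_mono_null (fun ω hω => ?_) h0
    simp only [mem_compl_iff, mem_ofPred_eq, not_exists, not_lt] at hω
    rw [limsup_eq_iInf_iSup_of_nat]
    simp only [iInf_eq_iInter, iSup_eq_iUnion, mem_iInter, mem_iUnion, mem_ofPred_eq]
    exact fun n => ⟨n, le_rfl, hω (n + 1)⟩
  filter_upwards [ae_all_iff.2 h] with ω hω t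
  obtain ⟨k, hk⟩ := exists_nat_ge t
  obtain ⟨n, hn⟩ := hω k
  exact ⟨n, hk.trans_lt hn⟩

lemma ae_holding_pos : ∀ᵐ ω ∂(noiseLaw r ν), ∀ n, 0 < (ω n).1 := by
  refine ae_all_iff.2 fun n => ?_
  have h0 : ∀ᵐ a ∂(holdingLaw r), 0 < a := by
    rw [ae_iff]
    have : {a : ℝ≥0 | ¬ 0 < a} = Iic 0 := by ext a; simp
    rw [this, holdingLaw_Iic hr.out]
    simp
  have h1 : ∀ᵐ w ∂((holdingLaw r).prod ν), 0 < w.1 :=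
    (Measure.quasiMeasurePreserving_fst (μ := holdingLaw r) (ν := ν)).ae h0
  exact (measurePreserving_eval_infinitePi
    (fun _ : ℕ => (holdingLaw r).prod ν) n).quasiMeasurePreserving.ae h1

end Noise

/-! ### The Markov property -/

section Markov

variable {S U : Type*} [MeasurableSpace U] [Inhabited S] [MeasurableSpace S] [Countable S]
  [DiscreteMeasurableSpace S] (r : ℝ) [hr : Fact (0 < r)]
  (ν : Measure U) [IsProbabilityMeasure ν] {f : S → U → S} (hf : ∀ x, Measurable (f x))

/-- The transition kernel of the jump process. -/
def jumpKernel (f : S → U → S) (t : ℝ≥0) : Kernel S S where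
  toFun x := (noiseLaw r ν).map (jumpProcess f x t)
  measurable' := .of_discrete

/-- The paths with exactly `n` jumps up to time `s` that visit `B i` at time `τ i` for `i ∈ F`. -/
def cylinder (f : S → U → S) (x : S) (s : ℝ≥0) (n : ℕ) {ι : Type*} (F : Finset ι) (τ : ι → ℝ≥0)
    (B : ι → Set S) : Set (ℕ → ℝ≥0 × U) :=
  {ω | jumpTime ω n ≤ s ∧ s < jumpTime ω (n + 1) ∧ ∀ i ∈ F, jumpProcess f x (τ i) ω ∈ B i}

include hf

lemma jumpKernel_apply (t : ℝ≥0) (x : S) (A : Set S) :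
    jumpKernel r ν f t x A = noiseLaw r ν {ω | jumpProcess f x t ω ∈ A} :=
  Measure.map_apply (measurable_jumpProcess hf x t) (.of_discrete)

lemma measurableSet_cylinder (x : S) (s : ℝ≥0) (n : ℕ) {ι : Type*} (F : Finset ι) (τ : ι → ℝ≥0)
    (B : ι → Set S) : MeasurableSet (cylinder f x s n F τ B) := by
  have h : cylinder f x s n F τ B = {ω | jumpTime ω n ≤ s} ∩ ({ω | s < jumpTime ω (n + 1)} ∩
      ⋂ i ∈ F, jumpProcess f x (τ i) ⁻¹' B i) := by
    ext ω; simp [cylinder]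
  rw [h]
  exact (measurable_jumpTime n measurableSet_Iic).inter
    ((measurable_jumpTime (n + 1) measurableSet_Ioi).inter
      (Finset.measurableSet_biInter _ fun i _ => measurable_jumpProcess hf x _ .of_discrete))

/-- The Markov property at time `s`, on the event of `n` jumps up to time `s`. The proof is by
induction on `n`, conditioning on the first jump; for `n = 0` it is the lack of memory of the
exponential law. -/
lemma noiseLaw_cylinder_inter (n : ℕ) (x : S) (s t : ℝ≥0) {ι : Type*} (F : Finset ι) (τ : ι → ℝ≥0)
    (hτ : ∀ i ∈ F, τ i ≤ s) (B : ι → Set S) (A : Set S) :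
    noiseLaw r ν (cylinder f x s n F τ B ∩ {ω | jumpProcess f x (s + t) ω ∈ A})
      = ∫⁻ ω in cylinder f x s n F τ B, jumpKernel r ν f t (jumpProcess f x s ω) A
          ∂(noiseLaw r ν) := by
  classical
  have hX : ∀ x t, Measurable (jumpProcess f x t) := measurable_jumpProcess hf
  have hXA : ∀ x t (A : Set S), MeasurableSet {ω | jumpProcess f x t ω ∈ A} :=
    fun x t A => hX x t (.of_discrete (s := A))
  have hQ : ∀ x s, Measurable fun ω => jumpKernel r ν f t (jumpProcess f x s ω) A := fun x s =>
    (Measurable.of_discrete (f := fun y => jumpKernel r ν f t y A)).comp (hX x s)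
  induction n generalizing x s F τ with
  | zero =>
    rw [noiseLaw_apply r ν ((measurableSet_cylinder hf x s 0 F τ B).inter
        (hXA x (s + t) A)),
      setLIntegral_noiseLaw r ν (measurableSet_cylinder hf x s 0 F τ B) (hQ x s)]
    by_cases hc : ∀ i ∈ F, x ∈ B i
    · have hcyl : ∀ (a : ℝ≥0) (u : U) ω, consSeq (a, u) ω ∈ cylinder f x s 0 F τ B ↔ s < a := by
        intro a u ω
        simp only [cylinder, mem_ofPred_eq, jumpTime_zero, zero_le, true_and, jumpTime_consSeq,
          add_zero]
        refine ⟨fun h => h.1, fun h => ⟨h, fun i hi => ?_⟩⟩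
        rw [jumpProcess_consSeq_of_lt f x (w := (a, u)) ω ((hτ i hi).trans_lt h)]
        exact hc i hi
      have hshift : ∀ (a : ℝ≥0) (u : U) ω, s < a → jumpProcess f x (s + t) (consSeq (a, u) ω)
          = jumpProcess f x t (consSeq (a - s, u) ω) := by
        intro a u ω ha
        by_cases h : a ≤ s + t
        · rw [jumpProcess_consSeq_of_le f x ω (w := (a, u)) h,
            jumpProcess_consSeq_of_le f x ω (w := (a - s, u)) (tsub_le_iff_left.2 h)]
          congr 1
          change s + t - a = t - (a - s)
          rw [← NNReal.coe_inj, NNReal.coe_sub h, NNReal.coe_sub (tsub_le_iff_left.2 h),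
            NNReal.coe_sub ha.le, NNReal.coe_add]
          ring
        · rw [not_le] at h
          rw [jumpProcess_consSeq_of_lt f x ω (w := (a, u)) h,
            jumpProcess_consSeq_of_lt f x ω (w := (a - s, u)) (lt_tsub_iff_left.2 h)]
      set g : ℝ≥0 → ℝ≥0∞ := fun a =>
        ∫⁻ u, noiseLaw r ν {ω | jumpProcess f x t (consSeq (a, u) ω) ∈ A} ∂ν with hg
      have hgm : Measurable g := by
        have h1 : MeasurableSet {p : ((ℝ≥0 × U) × (ℕ → ℝ≥0 × U)) |
            jumpProcess f x t (consSeq p.1 p.2) ∈ A} :=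
          ((hX x t).comp measurable_consSeq) .of_discrete
        exact (measurable_measure_prodMk_left (ν := noiseLaw r ν) h1).lintegral_prod_right'
      have hgint : ∫⁻ a, g a ∂(holdingLaw r) = jumpKernel r ν f t x A := by
        rw [jumpKernel_apply r ν hf, noiseLaw_apply r ν (hXA x t A)]
        rfl
      have hL : ∀ a, (∫⁻ u, noiseLaw r ν {ω | consSeq (a, u) ω ∈ cylinder f x s 0 F τ B ∩
          {ω | jumpProcess f x (s + t) ω ∈ A}} ∂ν)
            = (Ioi s).indicator (fun a => g (a - s)) a := by
        intro a
        by_cases ha : s < a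
        · rw [indicator_of_mem (by exact ha)]
          simp only [hg, mem_inter_iff, hcyl, ha, true_and, mem_ofPred_eq, hshift _ _ _ ha]
        · rw [indicator_of_notMem (by exact ha)]
          simp [hcyl, ha]
      have hR : ∀ a, (∫⁻ u, ∫⁻ ω in {ω | consSeq (a, u) ω ∈ cylinder f x s 0 F τ B},
          jumpKernel r ν f t (jumpProcess f x s (consSeq (a, u) ω)) A ∂(noiseLaw r ν) ∂ν)
            = (Ioi s).indicator (fun _ => jumpKernel r ν f t x A) a := by
        intro a
        by_cases ha : s < a
        · rw [indicator_of_mem (by exact ha)]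
          have h0 : ∀ (u : U) ω, jumpProcess f x s (consSeq (a, u) ω) = x :=
            fun u ω => jumpProcess_consSeq_of_lt f x ω ha
          simp only [hcyl, ha, h0]
          simp
        · rw [indicator_of_notMem (by exact ha)]
          simp [hcyl, ha]
      simp_rw [hL]
      refine Eq.trans ?_ (lintegral_congr hR).symm
      rw [lintegral_indicator measurableSet_Ioi, lintegral_indicator measurableSet_Ioi,
        lintegral_holdingLaw_sub hr.out s hgm, hgint, setLIntegral_const, mul_comm]
    · have hcyl : ∀ (a : ℝ≥0) (u : U) ω, consSeq (a, u) ω ∉ cylinder f x s 0 F τ B := by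
        rintro a u ω ⟨-, h, h'⟩
        refine hc fun i hi => ?_
        rw [jumpTime_consSeq, jumpTime_zero, add_zero] at h
        have := h' i hi
        rwa [jumpProcess_consSeq_of_lt f x (w := (a, u)) ω ((hτ i hi).trans_lt h)] at this
      simp [hcyl]
  | succ n ih =>
    rw [noiseLaw_apply r ν ((measurableSet_cylinder hf x s (n + 1) F τ B).inter
        (hXA x (s + t) A)),
      setLIntegral_noiseLaw r ν (measurableSet_cylinder hf x s (n + 1) F τ B) (hQ x s)]
    refine lintegral_congr fun a => lintegral_congr fun u => ?_
    by_cases hc : a ≤ s ∧ ∀ i ∈ F, τ i < a → x ∈ B i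
    · have has := hc.1
      have hcyl : ∀ ω, consSeq (a, u) ω ∈ cylinder f x s (n + 1) F τ B ↔
          ω ∈ cylinder f (f x u) (s - a) n (F.filter fun i => a ≤ τ i) (fun i => τ i - a) B := by
        intro ω
        simp only [cylinder, mem_ofPred_eq, jumpTime_consSeq, Finset.mem_filter]
        refine and_congr (le_tsub_iff_left has).symm
          (and_congr (tsub_lt_iff_left has).symm ⟨fun h i hi => ?_, fun h i hi => ?_⟩)
        · rw [← jumpProcess_consSeq_of_le f x (w := (a, u)) ω hi.2]
          exact h i hi.1
        · by_cases hia : a ≤ τ i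
          · rw [jumpProcess_consSeq_of_le f x (w := (a, u)) ω hia]
            exact h i ⟨hi, hia⟩
          · rw [not_le] at hia
            rw [jumpProcess_consSeq_of_lt f x (w := (a, u)) ω hia]
            exact hc.2 i hi hia
      have hX1 : ∀ ω, jumpProcess f x s (consSeq (a, u) ω) = jumpProcess f (f x u) (s - a) ω :=
        fun ω => jumpProcess_consSeq_of_le f x ω has
      have hX2 : ∀ ω, jumpProcess f x (s + t) (consSeq (a, u) ω)
          = jumpProcess f (f x u) (s - a + t) ω := fun ω => by
        rw [jumpProcess_consSeq_of_le f x ω (w := (a, u)) (has.trans le_self_add),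
          tsub_add_eq_add_tsub has]
      have := ih (f x u) (s - a) (F.filter fun i => a ≤ τ i) (fun i => τ i - a)
        fun i hi => tsub_le_tsub_right (hτ i (Finset.mem_filter.1 hi).1) a
      simp only [mem_inter_iff, hcyl, mem_ofPred_eq, hX1, hX2]
      exact this
    · have hcyl : ∀ ω, consSeq (a, u) ω ∉ cylinder f x s (n + 1) F τ B := by
        rintro ω ⟨h, -, h'⟩
        rw [jumpTime_consSeq] at h
        refine hc ⟨le_self_add.trans h, fun i hi hia => ?_⟩
        have := h' i hi
        rwa [jumpProcess_consSeq_of_lt f x (w := (a, u)) ω hia] at this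
      simp [hcyl]

/-- The Markov property at time `s`, tested on finitely many times of the past. -/
lemma noiseLaw_inter_jumpProcess (x : S) (s t : ℝ≥0) {ι : Type*} (F : Finset ι) (τ : ι → ℝ≥0)
    (hτ : ∀ i ∈ F, τ i ≤ s) (B : ι → Set S) (A : Set S) :
    noiseLaw r ν ({ω | ∀ i ∈ F, jumpProcess f x (τ i) ω ∈ B i} ∩
        {ω | jumpProcess f x (s + t) ω ∈ A})
      = ∫⁻ ω in {ω | ∀ i ∈ F, jumpProcess f x (τ i) ω ∈ B i},
          jumpKernel r ν f t (jumpProcess f x s ω) A ∂(noiseLaw r ν) := by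
  have hX : ∀ x t, Measurable (jumpProcess f x t) := measurable_jumpProcess hf
  have hXA : ∀ x t (A : Set S), MeasurableSet {ω | jumpProcess f x t ω ∈ A} :=
    fun x t A => hX x t (.of_discrete (s := A))
  have hdisj : Pairwise (Function.onFun Disjoint fun n => cylinder f x s n F τ B) := by
    have key : ∀ m n, m < n → Disjoint (cylinder f x s m F τ B) (cylinder f x s n F τ B) := by
      intro m n hmn
      rw [Set.disjoint_left]
      rintro ω ⟨-, h1, -⟩ ⟨h2, -, -⟩
      exact absurd (h1.trans_le ((monotone_jumpTime ω hmn).trans h2)) (lt_irrefl _)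
    intro m n hmn
    rcases lt_or_gt_of_ne hmn with h | h
    · exact key m n h
    · exact (key n m h).symm
  have hae : ({ω | ∀ i ∈ F, jumpProcess f x (τ i) ω ∈ B i} : Set (ℕ → ℝ≥0 × U))
      =ᵐ[noiseLaw r ν] ⋃ n, cylinder f x s n F τ B := by
    filter_upwards [ae_exists_lt_jumpTime r ν] with ω hω
    refine propext ⟨fun h => ?_, fun h => ?_⟩
    · rcases exists_jumpTime_or_forall_le ω s with ⟨n, h1, h2⟩ | h'
      · exact mem_iUnion.2 ⟨n, h1, h2, h⟩
      · obtain ⟨n, hn⟩ := hω s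
        exact absurd (h' n) (not_le.2 hn)
    · obtain ⟨n, hn⟩ := mem_iUnion.1 h
      exact hn.2.2
  have hm := fun n => measurableSet_cylinder hf x s n F τ B
  rw [setLIntegral_congr hae, lintegral_iUnion hm hdisj,
    measure_congr (hae.inter (ae_eq_refl {ω | jumpProcess f x (s + t) ω ∈ A})), iUnion_inter,
    measure_iUnion (fun m n hmn => (hdisj hmn).mono inter_subset_left inter_subset_left)
      fun n => (hm n).inter (hXA x _ A)]
  exact tsum_congr fun n => noiseLaw_cylinder_inter r ν hf n x s t F τ hτ B A

end Markov

/-! ### The semigroup and its generator -/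

section Semigroup

variable {S U : Type*} [MeasurableSpace U] (r : ℝ) [hr : Fact (0 < r)]
  (ν : Measure U) [IsProbabilityMeasure ν]

lemma jumpKernel_zero [Inhabited S] [MeasurableSpace S] [DiscreteMeasurableSpace S]
    (f : S → U → S) : jumpKernel r ν f 0 = Kernel.id := by
  ext1 x
  have h : jumpProcess f x 0 =ᵐ[noiseLaw r ν] fun _ => x := by
    filter_upwards [ae_holding_pos r ν] with ω hω
    exact jumpProcess_eq (n := 0) f x (by simp) (by simpa [jumpTime_succ] using hω 0)
  change (noiseLaw r ν).map (jumpProcess f x 0) = _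
  rw [Measure.map_congr h, Kernel.id_apply, Measure.map_const, measure_univ, one_smul]

lemma noiseLaw_jumpTime_two_le (h : ℝ≥0) :
    (noiseLaw r ν).real {ω | jumpTime ω 2 ≤ h} ≤ (r * h) ^ 2 := by
  have hle : holdingLaw r (Iic h) ≤ ENNReal.ofReal (r * h) := by
    rw [holdingLaw_Iic hr.out]
    refine ENNReal.ofReal_le_ofReal ?_
    linarith [Real.add_one_le_exp (-(r * (h : ℝ)))]
  have h1 : ∀ s ≤ h, noiseLaw r ν {ω | jumpTime ω 1 ≤ s} ≤ ENNReal.ofReal (r * h) := by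
    intro s hs
    rw [noiseLaw_jumpTime_succ_le]
    simp only [jumpTime_zero, zero_le]
    change ∫⁻ a in Iic s, noiseLaw r ν univ ∂_ ≤ _
    rw [measure_univ, setLIntegral_one]
    exact (measure_mono (Iic_subset_Iic.2 hs)).trans hle
  refine ENNReal.toReal_le_of_le_ofReal (by positivity) ?_
  rw [noiseLaw_jumpTime_succ_le r ν 1]
  calc ∫⁻ a in Iic h, noiseLaw r ν {ω | jumpTime ω 1 ≤ h - a} ∂(holdingLaw r)
      ≤ ∫⁻ a in Iic h, ENNReal.ofReal (r * h) ∂(holdingLaw r) :=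
        lintegral_mono fun a => h1 _ tsub_le_self
    _ ≤ ENNReal.ofReal (r * h) * ENNReal.ofReal (r * h) := by
        rw [setLIntegral_const]
        gcongr
    _ = ENNReal.ofReal ((r * h) ^ 2) := by
        have := hr.out
        rw [← ENNReal.ofReal_mul (by positivity), sq]

lemma abs_one_sub_exp_neg_sub_le {y : ℝ} (hy : 0 ≤ y) : |1 - Real.exp (-y) - y| ≤ y ^ 2 := by
  rw [abs_le]
  constructor
  · rcases le_or_gt y 1 with h | h
    · have := Real.abs_exp_sub_one_sub_id_le (x := -y) (by rwa [abs_neg, abs_of_nonneg hy])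
      rw [abs_le] at this
      nlinarith
    · have : Real.exp (-y) ≤ 1 := Real.exp_le_one_iff.2 (by linarith)
      nlinarith
  · have := Real.add_one_le_exp (-y)
    nlinarith [sq_nonneg y]

variable [Inhabited S] [MeasurableSpace S] [Countable S]
  [DiscreteMeasurableSpace S] {f : S → U → S} (hf : ∀ x, Measurable (f x))

include hf

lemma isMarkovKernel_jumpKernel (t : ℝ≥0) : IsMarkovKernel (jumpKernel r ν f t) :=
  ⟨fun x => Measure.isProbabilityMeasure_map (measurable_jumpProcess hf x t).aemeasurable⟩

/-- The Chapman–Kolmogorov equation. -/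
lemma jumpKernel_add (s t : ℝ≥0) :
    jumpKernel r ν f (s + t) = jumpKernel r ν f t ∘ₖ jumpKernel r ν f s := by
  ext x A hA
  rw [Kernel.comp_apply' _ _ _ hA, jumpKernel_apply r ν hf]
  have h := noiseLaw_inter_jumpProcess r ν hf x s t (ι := Unit) ∅ (fun _ => 0) (by simp)
    (fun _ => univ) A
  simp only [Finset.notMem_empty, false_imp_iff, implies_true] at h
  change noiseLaw r ν (univ ∩ _) = ∫⁻ ω in univ, _ ∂_ at h
  rw [univ_inter, Measure.restrict_univ] at h
  rw [h]
  exact (lintegral_map (Measurable.of_discrete (f := fun y => jumpKernel r ν f t y A))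
    (measurable_jumpProcess hf x s)).symm

/-- Over a short time `h` the process makes one jump with probability `r h + O(h²)`, and two jumps
with probability `O(h²)`. -/
lemma abs_integral_jumpKernel_sub_le {g : S → ℝ} {C : ℝ} (hC : ∀ x, |g x| ≤ C) (x : S) (h : ℝ≥0) :
    |(∫ y, g y ∂(jumpKernel r ν f h x)) - g x - r * h * ((∫ u, g (f x u) ∂ν) - g x)|
      ≤ (r * h) ^ 2 * (|(∫ u, g (f x u) ∂ν) - g x| + 2 * C) := by
  classical
  set a := (∫ u, g (f x u) ∂ν) - g x with ha
  have hg : Measurable g := .of_discrete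
  have hC0 : 0 ≤ C := (abs_nonneg _).trans (hC x)
  have hbdd : ∀ y z, |g y - g z| ≤ 2 * C := fun y z => by
    have := abs_le.1 (hC y); have := abs_le.1 (hC z)
    rw [abs_le]; constructor <;> linarith
  -- the contribution of the first jump
  set k : ℝ≥0 × U → ℝ := fun w => (Iic h).indicator 1 w.1 * (g (f x w.2) - g x) with hk
  have hkm : Measurable k :=
    ((measurable_one.indicator measurableSet_Iic).comp measurable_fst).mul
      (((hg.comp (hf x)).comp measurable_snd).sub_const _)
  have hev := measurePreserving_eval_infinitePi (fun _ : ℕ => (holdingLaw r).prod ν) 0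
  have hk1 : ∫ ω, k (ω 0) ∂(noiseLaw r ν) = (1 - Real.exp (-(r * h))) * a := by
    have h1 : ∫ ω, k (ω 0) ∂(noiseLaw r ν) = ∫ w, k w ∂((holdingLaw r).prod ν) := by
      rw [← hev.map_eq]
      exact (integral_map (measurable_pi_apply 0).aemeasurable hkm.aestronglyMeasurable).symm
    have h2 : Integrable (fun u => g (f x u)) ν :=
      Integrable.of_bound (hg.comp (hf x)).aestronglyMeasurable C
        (Eventually.of_forall fun u => by simpa using hC _)
    rw [h1, hk, integral_prod_mul (fun b : ℝ≥0 => (Iic h).indicator (1 : ℝ≥0 → ℝ) b)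
      (fun u => g (f x u) - g x), integral_indicator_one measurableSet_Iic,
      integral_sub h2 (integrable_const _), integral_const, measureReal_def, holdingLaw_Iic hr.out,
      ENNReal.toReal_ofReal]
    · simp [ha]
    · rw [sub_nonneg, Real.exp_le_one_iff]
      have := mul_nonneg hr.out.le h.coe_nonneg
      linarith
  have hXm : Measurable fun ω => g (jumpProcess f x h ω) := hg.comp (measurable_jumpProcess hf x h)
  have hkm' : Measurable fun ω : ℕ → ℝ≥0 × U => k (ω 0) := hkm.comp (measurable_pi_apply 0)
  have hXi : Integrable (fun ω => g (jumpProcess f x h ω)) (noiseLaw r ν) :=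
    Integrable.of_bound hXm.aestronglyMeasurable C
      (Eventually.of_forall fun ω => by simpa using hC _)
  have hki : Integrable (fun ω => k (ω 0)) (noiseLaw r ν) := by
    refine Integrable.of_bound hkm'.aestronglyMeasurable (2 * C) (Eventually.of_forall fun ω => ?_)
    simp only [hk, indicator_apply, Pi.one_apply, Real.norm_eq_abs]
    split_ifs
    · rw [one_mul]; exact hbdd _ _
    · simpa using hC0
  have hm2 : MeasurableSet {ω : ℕ → ℝ≥0 × U | jumpTime ω 2 ≤ h} :=
    measurable_jumpTime 2 measurableSet_Iic
  have herr : |∫ ω, (g (jumpProcess f x h ω) - g x - k (ω 0)) ∂(noiseLaw r ν)|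
      ≤ 2 * C * (r * h) ^ 2 := by
    have hb : ∀ ω : ℕ → ℝ≥0 × U, ‖g (jumpProcess f x h ω) - g x - k (ω 0)‖
        ≤ {ω : ℕ → ℝ≥0 × U | jumpTime ω 2 ≤ h}.indicator (fun _ => 2 * C) ω := by
      intro ω
      have hT1 : jumpTime ω 1 = (ω 0).1 := by simp [jumpTime]
      by_cases h1 : jumpTime ω 1 ≤ h
      · have hk' : k (ω 0) = g (chain f 1 x ω) - g x := by
          simp only [hk]
          rw [indicator_of_mem (by rw [← hT1]; exact h1), Pi.one_apply, one_mul]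
          rfl
        rw [hk', sub_sub_sub_cancel_right, Real.norm_eq_abs]
        by_cases h2 : jumpTime ω 2 ≤ h
        · rw [indicator_of_mem (by exact h2)]
          exact hbdd _ _
        · rw [jumpProcess_eq (n := 1) f x h1 (not_le.1 h2), sub_self, abs_zero]
          exact indicator_nonneg (fun _ _ => by positivity) _
      · have hk' : k (ω 0) = 0 := by
          simp only [hk]
          rw [indicator_of_notMem (by rw [← hT1]; exact h1), zero_mul]
        rw [hk', jumpProcess_eq (n := 0) f x (by simp) (not_le.1 h1)]
        simp only [chain, sub_self, norm_zero]
        exact indicator_nonneg (fun _ _ => by positivity) _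
    have := norm_integral_le_of_norm_le ((integrable_const (2 * C)).indicator hm2)
      (Eventually.of_forall hb : ∀ᵐ ω ∂(noiseLaw r ν), _)
    rw [integral_indicator_const _ hm2, smul_eq_mul] at this
    calc _ ≤ (noiseLaw r ν).real {ω | jumpTime ω 2 ≤ h} * (2 * C) := this
      _ ≤ (r * h) ^ 2 * (2 * C) := by
        gcongr
        exact noiseLaw_jumpTime_two_le r ν h
      _ = _ := mul_comm _ _
  have hint : ∫ y, g y ∂(jumpKernel r ν f h x) = ∫ ω, g (jumpProcess f x h ω) ∂(noiseLaw r ν) :=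
    integral_map (measurable_jumpProcess hf x h).aemeasurable hg.aestronglyMeasurable
  rw [integral_sub (f := fun ω => g (jumpProcess f x h ω) - g x) (hXi.sub (integrable_const _)) hki,
    integral_sub hXi (integrable_const _),
    hk1, ← hint, integral_const, probReal_univ, one_smul] at herr
  have hrh : 0 ≤ r * h := mul_nonneg hr.out.le h.coe_nonneg
  have h3 : |(1 - Real.exp (-(r * h)) - r * h) * a| ≤ (r * h) ^ 2 * |a| := by
    rw [abs_mul]
    gcongr
    exact abs_one_sub_exp_neg_sub_le hrh
  calc _ = |((∫ y, g y ∂(jumpKernel r ν f h x)) - g x - (1 - Real.exp (-(r * h))) * a)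
        + (1 - Real.exp (-(r * h)) - r * h) * a| := by congr 1; ring
    _ ≤ 2 * C * (r * h) ^ 2 + (r * h) ^ 2 * |a| := (abs_add_le _ _).trans (add_le_add herr h3)
    _ = _ := by ring

lemma tendsto_jumpKernel_div {g : S → ℝ} {C : ℝ} (hC : ∀ x, |g x| ≤ C) (x : S) :
    Tendsto (fun h : ℝ≥0 => ((∫ y, g y ∂(jumpKernel r ν f h x)) - g x) / (h : ℝ)) (𝓝[>] 0)
      (𝓝 (r * ((∫ u, g (f x u) ∂ν) - g x))) := by
  set a := (∫ u, g (f x u) ∂ν) - g x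
  have hlim : Tendsto (fun h : ℝ≥0 => r ^ 2 * (|a| + 2 * C) * (h : ℝ)) (𝓝[>] 0) (𝓝 0) := by
    have : Continuous fun h : ℝ≥0 => r ^ 2 * (|a| + 2 * C) * (h : ℝ) := by fun_prop
    simpa using (this.tendsto 0).mono_left nhdsWithin_le_nhds
  rw [tendsto_iff_norm_sub_tendsto_zero]
  refine squeeze_zero' (Eventually.of_forall fun _ => norm_nonneg _) ?_ hlim
  filter_upwards [self_mem_nhdsWithin] with h hh
  have hh' : (0 : ℝ) < h := hh
  have key := abs_integral_jumpKernel_sub_le r ν hf hC x h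
  have heq : ((∫ y, g y ∂(jumpKernel r ν f h x)) - g x) / (h : ℝ) - r * a
      = ((∫ y, g y ∂(jumpKernel r ν f h x)) - g x - r * h * a) / h := by
    field_simp
  rw [heq, Real.norm_eq_abs, abs_div, abs_of_pos hh', div_le_iff₀ hh']
  refine key.trans_eq ?_
  ring

end Semigroup

lemma isMarkovSemigroup_jumpKernel {S : Type} {U : Type*} [MeasurableSpace U] [Inhabited S]
    [MeasurableSpace S] [Countable S] [DiscreteMeasurableSpace S] (r : ℝ) [Fact (0 < r)]
    (ν : Measure U) [IsProbabilityMeasure ν] {f : S → U → S} (hf : ∀ x, Measurable (f x))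
    {A : (S → ℝ) → S → ℝ} (hA : ∀ g x, A g x = r * ((∫ u, g (f x u) ∂ν) - g x)) :
    IsMarkovSemigroup A (jumpKernel r ν f) where
  markov := isMarkovKernel_jumpKernel r ν hf
  zero := jumpKernel_zero r ν f
  add := jumpKernel_add r ν hf
  generator g _ hC x := by
    obtain ⟨C, hC⟩ := hC
    rw [hA g x]
    exact tendsto_jumpKernel_div r ν hf hC x

/-! ### The jump process is a Markov process -/

section Paths

variable {S U : Type*} [Inhabited S] [TopologicalSpace S] (f : S → U → S) (x : S)
  {ω : ℕ → ℝ≥0 × U} (hω : ∀ t : ℝ≥0, ∃ n, t < jumpTime ω n)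
include hω

lemma exists_jumpTime_le_lt (t : ℝ≥0) : ∃ n, jumpTime ω n ≤ t ∧ t < jumpTime ω (n + 1) := by
  rcases exists_jumpTime_or_forall_le ω t with h | h
  · exact h
  · obtain ⟨n, hn⟩ := hω t
    exact absurd (h n) (not_le.2 hn)

lemma continuousWithinAt_jumpProcess (t : ℝ≥0) :
    ContinuousWithinAt (fun u => jumpProcess f x u ω) (Ici t) t := by
  obtain ⟨n, h₁, h₂⟩ := exists_jumpTime_le_lt hω t
  refine tendsto_const_nhds.congr' ?_
  filter_upwards [self_mem_nhdsWithin, mem_nhdsWithin_of_mem_nhds (Iio_mem_nhds h₂)] with u hu hu'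
  rw [jumpProcess_eq f x h₁ h₂, jumpProcess_eq f x (h₁.trans hu) hu']

lemma exists_tendsto_jumpProcess_left (t : ℝ≥0) :
    ∃ y, Tendsto (fun u => jumpProcess f x u ω) (𝓝[<] t) (𝓝 y) := by
  classical
  rcases eq_zero_or_pos t with rfl | ht
  · refine ⟨x, ?_⟩
    have : Iio (0 : ℝ≥0) = ∅ := by ext a; simp
    rw [this, nhdsWithin_empty]
    exact tendsto_bot
  have h : ∃ n, t ≤ jumpTime ω n := (hω t).imp fun n hn => hn.le
  have hpos : Nat.find h ≠ 0 := fun h0 => by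
    have := Nat.find_spec h
    rw [h0, jumpTime_zero] at this
    exact absurd this (not_le.2 ht)
  obtain ⟨k, hk⟩ := Nat.exists_eq_succ_of_ne_zero hpos
  have h₁ : jumpTime ω k < t := not_le.1 (Nat.find_min h (by omega))
  have h₂ : t ≤ jumpTime ω (k + 1) := by
    have := Nat.find_spec h
    rwa [hk] at this
  refine ⟨chain f k x ω, tendsto_const_nhds.congr' ?_⟩
  filter_upwards [Ioo_mem_nhdsLT h₁] with u hu
  exact (jumpProcess_eq f x hu.1.le (hu.2.trans_le h₂)).symm

end Paths

/-- The jump process driven by the noise `p.2` is Markov, also when its starting point `π p.1` is a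
function of a further coordinate `p.1`, here with the value `e`. -/
theorem isMarkovProcess_jumpProcess {S U E : Type} [MeasurableSpace U] [Inhabited S]
    [MeasurableSpace S] [Countable S] [DiscreteMeasurableSpace S] [TopologicalSpace S]
    [MeasurableSpace E] (r : ℝ) [Fact (0 < r)] (ν : Measure U) [IsProbabilityMeasure ν]
    {f : S → U → S} (hf : ∀ x, Measurable (f x)) {A : (S → ℝ) → S → ℝ}
    (hA : ∀ g x, A g x = r * ((∫ u, g (f x u) ∂ν) - g x)) {π : E → S} (hπ : Measurable π) (e : E) :
    IsMarkovProcess A (fun t (p : E × (ℕ → ℝ≥0 × U)) => jumpProcess f (π p.1) t p.2)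
      ((noiseLaw r ν).map fun ω => (e, ω)) := by
  have hι : Measurable fun ω : ℕ → ℝ≥0 × U => (e, ω) := measurable_prodMk_left
  set P := (noiseLaw r ν).map fun ω => (e, ω) with hP
  have : IsProbabilityMeasure P := Measure.isProbabilityMeasure_map hι.aemeasurable
  set X : ℝ≥0 → E × (ℕ → ℝ≥0 × U) → S := fun t p => jumpProcess f (π p.1) t p.2 with hXdef
  have hX : ∀ t, Measurable (X t) := fun t => by
    have h : Measurable fun p : S × (ℕ → ℝ≥0 × U) => jumpProcess f p.1 t p.2 :=
      measurable_from_prod_countable_right fun y => measurable_jumpProcess hf y t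
    exact h.comp ((hπ.comp measurable_fst).prodMk measurable_snd)
  have hsnd : MeasurePreserving Prod.snd P (noiseLaw r ν) :=
    ⟨measurable_snd, by
      rw [hP, Measure.map_map measurable_snd hι]
      exact Measure.map_id⟩
  have hne : ∀ᵐ p ∂P, ∀ t : ℝ≥0, ∃ n, t < jumpTime p.2 n :=
    hsnd.quasiMeasurePreserving.ae (ae_exists_lt_jumpTime r ν)
  refine ⟨hX, ?_, ?_, jumpKernel r ν f, isMarkovSemigroup_jumpKernel r ν hf hA, ?_⟩
  · filter_upwards [hne] with p hp t using continuousWithinAt_jumpProcess f _ hp t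
  · filter_upwards [hne] with p hp t using exists_tendsto_jumpProcess_left f _ hp t
  intro s t B hB
  have := isMarkovKernel_jumpKernel r ν hf t
  set D : Set (E × (ℕ → ℝ≥0 × U)) := X (s + t) ⁻¹' B with hD
  have hDm : MeasurableSet D := hX (s + t) hB
  have hQm : Measurable fun p => jumpKernel r ν f t (X s p) B :=
    (Measurable.of_discrete (f := fun y => jumpKernel r ν f t y B)).comp (hX s)
  have hle : past X s ≤ (inferInstance : MeasurableSpace (E × (ℕ → ℝ≥0 × U))) :=
    iSup₂_le fun u _ => (hX u).comap_le
  -- the identity on cylinders extends to the whole past by the `π`-`λ` theorem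
  have hcyl : ∀ (F : Finset ℝ≥0) (B' : ℝ≥0 → Set S), (∀ u ∈ F, u ≤ s) →
      P.restrict D (⋂ u ∈ F, X u ⁻¹' B' u)
        = P.withDensity (fun p => jumpKernel r ν f t (X s p) B) (⋂ u ∈ F, X u ⁻¹' B' u) := by
    intro F B' hF
    have hCm : MeasurableSet (⋂ u ∈ F, X u ⁻¹' B' u) :=
      Finset.measurableSet_biInter _ fun u _ => hX u .of_discrete
    have hpre : (fun ω : ℕ → ℝ≥0 × U => (e, ω)) ⁻¹' (⋂ u ∈ F, X u ⁻¹' B' u)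
        = {ω | ∀ u ∈ F, jumpProcess f (π e) u ω ∈ B' u} := by
      ext ω; simp [hXdef]
    rw [Measure.restrict_apply hCm, withDensity_apply _ hCm, hP,
      setLIntegral_map hCm hQm hι, Measure.map_apply hι (hCm.inter hDm), preimage_inter, hpre]
    exact noiseLaw_inter_jumpProcess r ν hf (π e) s t F id hF B' B
  have hfin : IsFiniteMeasure (P.restrict D) := inferInstance
  have hgen : past X s = MeasurableSpace.generateFrom
      (piiUnionInter (fun u => {C | MeasurableSet[MeasurableSpace.comap (X u) inferInstance] C})
        (Iic s)) :=
    (generateFrom_piiUnionInter_measurableSet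
      (fun u => MeasurableSpace.comap (X u) inferInstance) (Iic s)).symm
  have hpast : ∀ C, MeasurableSet[past X s] C → P.restrict D C
      = P.withDensity (fun p => jumpKernel r ν f t (X s p) B) C := by
    intro C hC
    refine ext_on_measurableSpace_of_generate_finite _ _ ?_ hle hgen
      (isPiSystem_piiUnionInter _ (fun u =>
        @MeasurableSpace.isPiSystem_measurableSet _ (MeasurableSpace.comap (X u) inferInstance)) _)
      ?_ hC
    · rintro _ ⟨F, hF, g, hg, rfl⟩
      have hg' : ∀ u, ∃ B' : Set S, u ∈ F → X u ⁻¹' B' = g u := fun u => by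
        by_cases hu : u ∈ F
        · obtain ⟨B', -, hB'⟩ := hg u hu
          exact ⟨B', fun _ => hB'⟩
        · exact ⟨∅, fun h => absurd h hu⟩
      choose B' hB' using hg'
      have : (⋂ u ∈ F, g u) = ⋂ u ∈ F, X u ⁻¹' B' u :=
        iInter₂_congr fun u hu => (hB' u hu).symm
      rw [this]
      exact hcyl F B' fun u hu => hF hu
    · simpa using hcyl ∅ (fun _ => univ) (by simp)
  have hQint : Integrable (fun p => (jumpKernel r ν f t (X s p)).real B) P :=
    Integrable.of_bound hQm.ennreal_toReal.aestronglyMeasurable 1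
      (Eventually.of_forall fun p => by
        rw [Real.norm_eq_abs, abs_of_nonneg measureReal_nonneg]; exact measureReal_le_one)
  refine (ae_eq_condExp_of_forall_setIntegral_eq hle ((integrable_const 1).indicator hDm)
    (fun _ _ _ => hQint.integrableOn) (fun C hC _ => ?_) ?_).symm
  · have h1 := hpast C hC
    rw [Measure.restrict_apply (hle C hC), withDensity_apply _ (hle C hC)] at h1
    rw [setIntegral_indicator hDm, setIntegral_const, smul_eq_mul, mul_one, measureReal_def, h1]
    exact integral_toReal hQm.aemeasurable (Eventually.of_forall fun p => measure_lt_top _ _)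
  · have hXs : Measurable[past X s] (X s) := by
      refine Measurable.mono (comap_measurable (X s)) ?_ le_rfl
      exact le_iSup₂_of_le s le_rfl le_rfl
    exact ((Measurable.of_discrete (f := fun y => (jumpKernel r ν f t y).real B)).comp
      hXs).aestronglyMeasurable

/-! ### Two jump processes driven by the same noise -/

section Decoupling

variable {S U : Type}

/-- The jump `n + 1` happens before time `t` and separates the two chains, which agree and are in
`A` after `n` jumps. -/
def decouplingEvent (f₁ f₂ : S → U → S) (A : Set S) (n : ℕ) (x y : S) (t : ℝ≥0) :
    Set (ℕ → ℝ≥0 × U) :=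
  {ω | jumpTime ω (n + 1) ≤ t ∧ ∃ z ∈ A, chain f₁ n x ω = z ∧ chain f₂ n y ω = z ∧
    f₁ z (ω n).2 ≠ f₂ z (ω n).2}

lemma consSeq_mem_decouplingEvent_succ (f₁ f₂ : S → U → S) (A : Set S) (n : ℕ) (x y : S)
    (t a : ℝ≥0) (u : U) (ω : ℕ → ℝ≥0 × U) :
    consSeq (a, u) ω ∈ decouplingEvent f₁ f₂ A (n + 1) x y t ↔
      a ≤ t ∧ ω ∈ decouplingEvent f₁ f₂ A n (f₁ x u) (f₂ y u) (t - a) := by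
  simp only [decouplingEvent, mem_ofPred_eq, jumpTime_consSeq (n := n + 1), consSeq_succ, chain,
    consSeq_zero, shift_consSeq]
  constructor
  · rintro ⟨h, h'⟩
    have ha : a ≤ t := le_self_add.trans h
    exact ⟨ha, (le_tsub_iff_left ha).2 h, h'⟩
  · rintro ⟨ha, h, h'⟩
    exact ⟨(le_tsub_iff_left ha).1 h, h'⟩

/-- If the processes separate before time `t`, and not after the second one has left `A`, then one
of the jumps up to time `t` separates them inside `A`. -/
lemma exists_mem_decouplingEvent [Inhabited S] {f₁ f₂ : S → U → S} {A : Set S} {x : S} {t : ℝ≥0}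
    {ω : ℕ → ℝ≥0 × U} (hω : ∀ t : ℝ≥0, ∃ n, t < jumpTime ω n) (hpos : ∀ n, 0 < (ω n).1)
    (hσ : decouplingTime (jumpProcess f₁ x) (jumpProcess f₂ x) ω ≤ t)
    (hτ : decouplingTime (jumpProcess f₁ x) (jumpProcess f₂ x) ω
      ≤ exitTime A (jumpProcess f₂ x) ω) :
    ∃ n, ω ∈ decouplingEvent f₁ f₂ A n x x t := by
  classical
  have hne : ∃ n, chain f₁ n x ω ≠ chain f₂ n x ω := by
    by_contra! h
    have : decouplingTime (jumpProcess f₁ x) (jumpProcess f₂ x) ω = ⊤ := by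
      refine iInf₂_eq_top.2 fun u hu => absurd ?_ hu
      obtain ⟨n, h₁, h₂⟩ := exists_jumpTime_le_lt hω u
      rw [jumpProcess_eq f₁ x h₁ h₂, jumpProcess_eq f₂ x h₁ h₂, h n]
    rw [this] at hσ
    exact absurd hσ (by simp)
  have h0 : Nat.find hne ≠ 0 := fun h0 => by
    have := Nat.find_spec hne
    rw [h0] at this
    exact this rfl
  obtain ⟨k, hk⟩ := Nat.exists_eq_succ_of_ne_zero h0
  have heq : chain f₁ k x ω = chain f₂ k x ω := by
    by_contra h
    exact Nat.find_min hne (by omega : k < Nat.find hne) h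
  have hsucc : chain f₁ (k + 1) x ω ≠ chain f₂ (k + 1) x ω := by
    have := Nat.find_spec hne
    rwa [hk] at this
  have hlt : jumpTime ω k < jumpTime ω (k + 1) := by
    rw [jumpTime_succ]; exact lt_add_of_pos_right _ (hpos k)
  have hσ' : (jumpTime ω (k + 1) : ℝ≥0∞)
      ≤ decouplingTime (jumpProcess f₁ x) (jumpProcess f₂ x) ω := by
    refine le_iInf₂ fun u hu => ENNReal.coe_le_coe.2 ?_
    obtain ⟨n, h₁, h₂⟩ := exists_jumpTime_le_lt hω u
    rw [jumpProcess_eq f₁ x h₁ h₂, jumpProcess_eq f₂ x h₁ h₂] at hu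
    exact (monotone_jumpTime ω (hk.symm.trans_le (Nat.find_min' hne hu))).trans h₁
  have hA : chain f₂ k x ω ∈ A := by
    by_contra hA
    have : exitTime A (jumpProcess f₂ x) ω ≤ jumpTime ω k :=
      iInf₂_le (jumpTime ω k) (by rwa [jumpProcess_eq f₂ x le_rfl hlt])
    exact absurd (ENNReal.coe_le_coe.1 ((hσ'.trans hτ).trans this)) (not_le.2 hlt)
  refine ⟨k, ENNReal.coe_le_coe.1 (hσ'.trans hσ), _, hA, heq, rfl, ?_⟩
  rwa [chain_succ, chain_succ, heq] at hsucc

variable [MeasurableSpace U] [MeasurableSpace S] [Countable S] [DiscreteMeasurableSpace S]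
  {f₁ f₂ : S → U → S} (hf₁ : ∀ x, Measurable (f₁ x)) (hf₂ : ∀ x, Measurable (f₂ x))
  (r : ℝ) [hr : Fact (0 < r)] (ν : Measure U) [IsProbabilityMeasure ν] {A : Set S} {δ : ℝ≥0∞}
  (hδ : δ ≠ ⊤) (hA : ∀ z ∈ A, ν {u | f₁ z u ≠ f₂ z u} ≤ δ)
include hf₁ hf₂

lemma measurableSet_decouplingEvent (A : Set S) (n : ℕ) (x y : S) (t : ℝ≥0) :
    MeasurableSet (decouplingEvent f₁ f₂ A n x y t) := by
  have h : decouplingEvent f₁ f₂ A n x y t = {ω | jumpTime ω (n + 1) ≤ t} ∩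
      ⋃ z ∈ A, (chain f₁ n x ⁻¹' {z} ∩ (chain f₂ n y ⁻¹' {z} ∩
        {ω | f₁ z (ω n).2 = f₂ z (ω n).2}ᶜ)) := by
    ext ω
    simp only [decouplingEvent, mem_ofPred_eq, mem_inter_iff, mem_iUnion, mem_preimage,
      mem_singleton_iff, mem_compl_iff, exists_prop]
  rw [h]
  refine (measurable_jumpTime _ measurableSet_Iic).inter
    (MeasurableSet.biUnion (to_countable A) fun z _ => ?_)
  refine (measurable_chain hf₁ n x (.of_discrete)).inter
    ((measurable_chain hf₂ n y (.of_discrete)).inter (MeasurableSet.compl ?_))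
  have hm : Measurable fun ω : ℕ → ℝ≥0 × U => (ω n).2 :=
    measurable_snd.comp (measurable_pi_apply n)
  exact measurableSet_eq_fun ((hf₁ z).comp hm) ((hf₂ z).comp hm)

include hδ hA

lemma noiseLaw_decouplingEvent_le (n : ℕ) (x y : S) (t : ℝ≥0) :
    noiseLaw r ν (decouplingEvent f₁ f₂ A n x y t)
      ≤ δ * noiseLaw r ν {ω | jumpTime ω (n + 1) ≤ t} := by
  rw [noiseLaw_apply r ν (measurableSet_decouplingEvent hf₁ hf₂ A n x y t),
    noiseLaw_jumpTime_succ_le, ← lintegral_const_mul' δ _ hδ, ← lintegral_indicator measurableSet_Iic]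
  refine lintegral_mono fun a => ?_
  by_cases ha : a ≤ t
  · rw [indicator_of_mem (by exact ha)]
    cases n with
    | zero =>
      have h1 : ∀ u, noiseLaw r ν {ω | consSeq (a, u) ω ∈ decouplingEvent f₁ f₂ A 0 x y t}
          ≤ ({u | x ∈ A ∧ f₁ x u ≠ f₂ x u} : Set U).indicator 1 u := by
        intro u
        by_cases hu : x ∈ A ∧ f₁ x u ≠ f₂ x u
        · rw [indicator_of_mem (by exact hu)]
          exact prob_le_one
        · have : {ω | consSeq (a, u) ω ∈ decouplingEvent f₁ f₂ A 0 x y t} = ∅ := by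
            ext ω
            simp only [mem_ofPred_eq, mem_empty_iff_false, iff_false]
            rintro ⟨-, z, hz, rfl, -, hne⟩
            exact hu ⟨hz, hne⟩
          rw [this, measure_empty]
          exact zero_le
      have h2 : ν {u | x ∈ A ∧ f₁ x u ≠ f₂ x u} ≤ δ := by
        by_cases hx : x ∈ A
        · simpa [hx] using hA x hx
        · simp [hx]
      have h3 : noiseLaw r ν {ω | jumpTime ω 0 ≤ t - a} = 1 := by
        simp only [jumpTime_zero, zero_le]
        exact measure_univ
      rw [h3, mul_one]
      exact (lintegral_mono h1).trans ((lintegral_indicator_one_le _).trans h2)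
    | succ n =>
      refine (lintegral_mono (g := fun _ => δ * noiseLaw r ν {ω | jumpTime ω (n + 1) ≤ t - a})
        fun u => ?_).trans_eq (by simp)
      simp only [consSeq_mem_decouplingEvent_succ, ha, true_and]
      exact noiseLaw_decouplingEvent_le n (f₁ x u) (f₂ y u) (t - a)
  · rw [indicator_of_notMem (by exact ha)]
    have : ∀ u, {ω | consSeq (a, u) ω ∈ decouplingEvent f₁ f₂ A n x y t} = ∅ := by
      intro u
      ext ω
      simp only [mem_ofPred_eq, mem_empty_iff_false, iff_false]
      rintro ⟨h, -⟩
      rw [jumpTime_consSeq] at h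
      exact ha (le_self_add.trans h)
    simp [this]

/-- The mean number of jumps up to time `t` is at most `r t`, and each of them separates the processes
inside `A` with probability at most `δ`. -/
lemma noiseLaw_decouplingTime_le [Inhabited S] (x : S) (t : ℝ≥0) :
    noiseLaw r ν {ω | decouplingTime (jumpProcess f₁ x) (jumpProcess f₂ x) ω ≤ t ∧
        decouplingTime (jumpProcess f₁ x) (jumpProcess f₂ x) ω ≤ exitTime A (jumpProcess f₂ x) ω}
      ≤ δ * ENNReal.ofReal (r * t) := by
  have hsub : ({ω | decouplingTime (jumpProcess f₁ x) (jumpProcess f₂ x) ω ≤ t ∧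
      decouplingTime (jumpProcess f₁ x) (jumpProcess f₂ x) ω ≤ exitTime A (jumpProcess f₂ x) ω} :
        Set (ℕ → ℝ≥0 × U)) ≤ᵐ[noiseLaw r ν] ⋃ n, decouplingEvent f₁ f₂ A n x x t := by
    filter_upwards [ae_exists_lt_jumpTime r ν, ae_holding_pos r ν] with ω h₁ h₂ h
    exact mem_iUnion.2 (exists_mem_decouplingEvent h₁ h₂ h.1 h.2)
  calc _ ≤ noiseLaw r ν (⋃ n, decouplingEvent f₁ f₂ A n x x t) := measure_mono_ae hsub
    _ ≤ ∑' n, noiseLaw r ν (decouplingEvent f₁ f₂ A n x x t) := measure_iUnion_le _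
    _ ≤ ∑' n, δ * noiseLaw r ν {ω | jumpTime ω (n + 1) ≤ t} :=
      ENNReal.tsum_le_tsum fun n => noiseLaw_decouplingEvent_le hf₁ hf₂ r ν hδ hA n x x t
    _ = δ * ∑' n, noiseLaw r ν {ω | jumpTime ω (n + 1) ≤ t} := ENNReal.tsum_mul_left
    _ ≤ _ := by gcongr; exact tsum_noiseLaw_jumpTime_le r ν t

end Decoupling

/-! ### The graphical representation of the interface dynamics -/

section Graphical

variable {L : ℕ}

/-- The `2L` moves: up or down at one of the sites. -/
def move (j : Fin L × Bool) : Config L :=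
  if j.2 then Pi.single j.1 1 else -Pi.single j.1 1

lemma move_injective : Function.Injective (move : Fin L × Bool → Config L) := by
  rintro ⟨k, b⟩ ⟨k', b'⟩ h
  have h1 := congrFun h k
  by_cases hk : k = k'
  · subst hk
    cases b <;> cases b' <;> simp [move] at h1 ⊢
  · cases b <;> cases b' <;> simp [move, hk] at h1

lemma isMove_iff {φ ψ : Config L} : IsMove φ ψ ↔ ∃ j, ψ = φ + move j := by
  constructor
  · rintro ⟨k, h | h⟩
    · exact ⟨(k, true), by simpa [move] using h⟩
    · exact ⟨(k, false), by simpa [move, sub_eq_add_neg] using h⟩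
  · rintro ⟨⟨k, b⟩, h⟩
    refine ⟨k, ?_⟩
    cases b
    · right; simpa [move, sub_eq_add_neg] using h
    · left; simpa [move] using h

lemma jumpRate_nonneg (μ : Config L → ℝ) (φ ψ : Config L) : 0 ≤ jumpRate μ φ ψ := by
  unfold jumpRate
  split_ifs
  exacts [Real.sqrt_nonneg _, le_rfl]

lemma generator_eq_sum (μ : Config L → ℝ) (g : Config L → ℝ) (φ : Config L) :
    generator μ g φ
      = ∑ j : Fin L × Bool, jumpRate μ φ (φ + move j) * (g (φ + move j) - g φ) := by
  classical
  have hinj : Function.Injective fun j : Fin L × Bool => φ + move j :=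
    (add_right_injective φ).comp move_injective
  rw [generator, tsum_eq_sum (s := Finset.univ.image fun j : Fin L × Bool => φ + move j),
    Finset.sum_image hinj.injOn]
  intro ψ hψ
  have : ¬ IsMove φ ψ := fun h => by
    obtain ⟨j, rfl⟩ := isMove_iff.1 h
    exact hψ (Finset.mem_image_of_mem _ (Finset.mem_univ j))
  simp [jumpRate, this]

/-- The uniform law on `[0, 1]`. -/
def unitLaw : Measure ℝ := volume.restrict (Icc 0 1)

instance : IsProbabilityMeasure unitLaw := ⟨by simp [unitLaw]⟩

lemma unitLaw_real_Iic {p : ℝ} (h0 : 0 ≤ p) (h1 : p ≤ 1) : unitLaw.real (Iic p) = p := by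
  have : Iic p ∩ Icc 0 1 = Icc 0 p := by
    ext v
    simp only [mem_inter_iff, mem_Iic, mem_Icc]
    exact ⟨fun h => ⟨h.2.1, h.1⟩, fun h => ⟨h.2, h.1, h.2.trans h1⟩⟩
  rw [measureReal_def, unitLaw, Measure.restrict_apply measurableSet_Iic, this, Real.volume_Icc,
    sub_zero, ENNReal.toReal_ofReal h0]

/-- The law of the marks: a uniformly chosen move, and an independent uniform variable on
`[0, 1]`. -/
def markLaw (L : ℕ) [NeZero L] : Measure ((Fin L × Bool) × ℝ) :=
  (PMF.uniformOfFintype (Fin L × Bool)).toMeasure.prod unitLaw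

instance [NeZero L] : IsProbabilityMeasure (markLaw L) := by
  unfold markLaw; infer_instance

/-- The mark `(j, v)` proposes the move `j`, which is accepted if `v ≤ c / R`, where `c` is the rate
of the move. -/
def applyMark (μ : Config L → ℝ) (R : ℝ) (φ : Config L) (u : (Fin L × Bool) × ℝ) : Config L :=
  if u.2 ≤ jumpRate μ φ (φ + move u.1) / R then φ + move u.1 else φ

lemma measurable_applyMark (μ : Config L → ℝ) (R : ℝ) (φ : Config L) :
    Measurable (applyMark μ R φ) := by
  refine measurable_from_prod_countable_right fun j => ?_
  exact Measurable.ite (f := fun _ => φ + move j) (g := fun _ => φ)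
    (measurableSet_Iic (a := jumpRate μ φ (φ + move j) / R)) measurable_const measurable_const

/-- A jump process with jumps at rate `2LR`, and marks of law `markLaw L`, performs the move `j`
at the rate `2LR · (2L)⁻¹ · (c / R) = c`. -/
lemma generator_eq_integral_markLaw [NeZero L] (μ : Config L → ℝ) {R : ℝ} (hR : 0 < R)
    (hμ : ∀ φ ψ, jumpRate μ φ ψ ≤ R) (g : Config L → ℝ) (φ : Config L) :
    generator μ g φ = 2 * L * R * ((∫ u, g (applyMark μ R φ u) ∂(markLaw L)) - g φ) := by
  have hL : (L : ℝ) ≠ 0 := Nat.cast_ne_zero.2 (NeZero.ne L)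
  have hg : Measurable fun u => g (applyMark μ R φ u) :=
    (Measurable.of_discrete (f := g)).comp (measurable_applyMark μ R φ)
  have hint : Integrable (fun u => g (applyMark μ R φ u)) (markLaw L) := by
    refine Integrable.of_bound hg.aestronglyMeasurable
      (|g φ| + ∑ j : Fin L × Bool, |g (φ + move j)|) (Eventually.of_forall fun u => ?_)
    rw [Real.norm_eq_abs, applyMark]
    have h1 := Finset.single_le_sum (f := fun j : Fin L × Bool => |g (φ + move j)|)
      (fun j _ => abs_nonneg _) (Finset.mem_univ u.1)
    have h2 : 0 ≤ ∑ j : Fin L × Bool, |g (φ + move j)| :=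
      Finset.sum_nonneg fun j _ => abs_nonneg _
    have h3 := abs_nonneg (g φ)
    split_ifs <;> linarith
  have hinner : ∀ j : Fin L × Bool, ∫ v, g (applyMark μ R φ (j, v)) ∂unitLaw
      = g φ + jumpRate μ φ (φ + move j) / R * (g (φ + move j) - g φ) := by
    intro j
    have h1 : ∀ v, g (applyMark μ R φ (j, v)) = g φ +
        (Iic (jumpRate μ φ (φ + move j) / R)).indicator (fun _ => g (φ + move j) - g φ) v := by
      intro v
      by_cases hv : v ≤ jumpRate μ φ (φ + move j) / R
      · rw [indicator_of_mem (by exact hv), applyMark, if_pos hv]; ring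
      · rw [indicator_of_notMem (by exact hv), applyMark, if_neg hv, add_zero]
    simp_rw [h1]
    rw [integral_add (integrable_const _) ((integrable_const _).indicator measurableSet_Iic),
      integral_const, probReal_univ, one_smul, integral_indicator_const _ measurableSet_Iic,
      unitLaw_real_Iic (div_nonneg (jumpRate_nonneg _ _ _) hR.le) ((div_le_one hR).2 (hμ _ _)),
      smul_eq_mul]
  have hcard : (Fintype.card (Fin L × Bool) : ℝ) = 2 * L := by simp [mul_comm]
  rw [generator_eq_sum, markLaw, integral_prod _ hint, PMF.integral_eq_sum]
  simp_rw [hinner, PMF.uniformOfFintype_apply, ENNReal.toReal_inv, ENNReal.toReal_natCast, hcard,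
    smul_eq_mul, mul_add, Finset.sum_add_distrib]
  rw [Finset.sum_const, Finset.card_univ, nsmul_eq_mul, hcard, mul_sub, mul_add, Finset.mul_sum]
  have h2 : 2 * (L : ℝ) * R * (2 * L * ((2 * (L : ℝ))⁻¹ * g φ)) = 2 * L * R * g φ := by
    field_simp
  rw [h2, add_sub_cancel_left]
  refine Finset.sum_congr rfl fun j _ => ?_
  field_simp

/-- The same mark is treated differently only if its threshold lies between the two acceptance
probabilities. -/
lemma markLaw_applyMark_ne_le [NeZero L] (μ₁ μ₂ : Config L → ℝ) {R : ℝ} (hR : 0 < R) {δ : ℝ}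
    {φ : Config L} (hδ : ∀ j, |jumpRate μ₁ φ (φ + move j) - jumpRate μ₂ φ (φ + move j)| ≤ δ) :
    markLaw L {u | applyMark μ₁ R φ u ≠ applyMark μ₂ R φ u} ≤ ENNReal.ofReal (δ / R) := by
  have hm : MeasurableSet {u | applyMark μ₁ R φ u ≠ applyMark μ₂ R φ u} :=
    (measurableSet_eq_fun (measurable_applyMark μ₁ R φ) (measurable_applyMark μ₂ R φ)).compl
  rw [markLaw, Measure.prod_apply hm]
  refine (lintegral_mono (g := fun _ => ENNReal.ofReal (δ / R)) fun j => ?_).trans_eq (by simp)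
  set p := jumpRate μ₁ φ (φ + move j) / R
  set q := jumpRate μ₂ φ (φ + move j) / R
  have hsub : Prod.mk j ⁻¹' {u | applyMark μ₁ R φ u ≠ applyMark μ₂ R φ u} ⊆ uIcc p q := by
    intro v hv
    simp only [mem_preimage, mem_ofPred_eq, applyMark] at hv
    rw [mem_uIcc]
    by_contra! h
    refine hv ?_
    by_cases h1 : v ≤ p
    · have h2 : v ≤ q := by
        by_contra! h2
        exact absurd (h.2 h2.le) (not_lt.2 h1)
      rw [if_pos h1, if_pos h2]
    · have h2 : ¬ v ≤ q := fun h2 => absurd (h.1 (not_le.1 h1).le) (not_lt.2 h2)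
      rw [if_neg h1, if_neg h2]
  calc unitLaw (Prod.mk j ⁻¹' {u | applyMark μ₁ R φ u ≠ applyMark μ₂ R φ u})
      ≤ volume (uIcc p q) := (Measure.restrict_apply_le _ _).trans (measure_mono hsub)
    _ = ENNReal.ofReal |q - p| := Real.volume_interval
    _ ≤ ENNReal.ofReal (δ / R) := by
      refine ENNReal.ofReal_le_ofReal ?_
      rw [abs_sub_comm, ← sub_div, abs_div, abs_of_pos hR]
      gcongr
      exact hδ j

/-- The coupling: two dynamics with rates at most `R` driven by the same noise separate, while in a
region where their rates differ by at most `δ`, at a rate at most `2Lδ`. -/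
theorem exists_coupling (hL : 0 < L) (μ₁ μ₂ : Config L → ℝ) {R : ℝ} (hR : 0 < R)
    (h₁ : ∀ φ ψ, jumpRate μ₁ φ ψ ≤ R) (h₂ : ∀ φ ψ, jumpRate μ₂ φ ψ ≤ R) :
    ∃ (Ω : Type) (_ : MeasurableSpace Ω) (P : Config L → Config L → Measure Ω)
      (X Y : ℝ≥0 → Ω → Config L),
      (∀ φ φ' : Config L, IsProbabilityMeasure (P φ φ') ∧
        P φ φ' {ω | X 0 ω = φ ∧ Y 0 ω = φ'} = 1 ∧
        IsMarkovProcess (generator μ₁) X (P φ φ') ∧ IsMarkovProcess (generator μ₂) Y (P φ φ')) ∧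
      ∀ (A : Set (Config L)) (δ : ℝ), (∀ φ ∈ A, ∀ j,
          |jumpRate μ₁ φ (φ + move j) - jumpRate μ₂ φ (φ + move j)| ≤ δ) →
        ∀ (φ : Config L) (t : ℝ≥0),
          P φ φ {ω | decouplingTime X Y ω ≤ (t : ℝ≥0∞) ∧ decouplingTime X Y ω ≤ exitTime A Y ω}
            ≤ ENNReal.ofReal (2 * L * δ * t) := by
  have : NeZero L := ⟨hL.ne'⟩
  have hL' : (0 : ℝ) < L := Nat.cast_pos.2 hL
  have : Fact (0 < 2 * L * R) := ⟨by positivity⟩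
  set f₁ := applyMark μ₁ R
  set f₂ := applyMark μ₂ R
  have hf₁ : ∀ φ, Measurable (f₁ φ) := measurable_applyMark μ₁ R
  have hf₂ : ∀ φ, Measurable (f₂ φ) := measurable_applyMark μ₂ R
  refine ⟨(Config L × Config L) × (ℕ → ℝ≥0 × ((Fin L × Bool) × ℝ)), inferInstance,
    fun φ φ' => (noiseLaw (2 * L * R) (markLaw L)).map fun ω => ((φ, φ'), ω),
    fun t p => jumpProcess f₁ p.1.1 t p.2, fun t p => jumpProcess f₂ p.1.2 t p.2, ?_, ?_⟩
  · intro φ φ'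
    have hP : IsProbabilityMeasure
        ((noiseLaw (2 * L * R) (markLaw L)).map fun ω => ((φ, φ'), ω)) :=
      Measure.isProbabilityMeasure_map measurable_prodMk_left.aemeasurable
    refine ⟨hP, ?_,
      isMarkovProcess_jumpProcess (2 * L * R) (markLaw L) hf₁
        (generator_eq_integral_markLaw μ₁ hR h₁) measurable_fst (φ, φ'),
      isMarkovProcess_jumpProcess (2 * L * R) (markLaw L) hf₂
        (generator_eq_integral_markLaw μ₂ hR h₂) measurable_snd (φ, φ')⟩
    refine ((measurableEmbedding_prodMk_left (φ, φ')).map_apply _ _).trans ?_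
    refine (measure_congr (t := univ) (eventuallyEq_univ.2 ?_)).trans measure_univ
    filter_upwards [ae_holding_pos (2 * L * R) (markLaw L)] with ω hω
    have hω0 : 0 < jumpTime ω (0 + 1) := by simpa [jumpTime_succ] using hω 0
    exact ⟨jumpProcess_eq (n := 0) f₁ φ (by simp) hω0, jumpProcess_eq (n := 0) f₂ φ' (by simp) hω0⟩
  · intro A δ hA φ t
    refine ((measurableEmbedding_prodMk_left (φ, φ)).map_apply _ _).trans_le ?_
    refine (noiseLaw_decouplingTime_le hf₁ hf₂ (2 * L * R) (markLaw L) ENNReal.ofReal_ne_top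
      (fun z hz => markLaw_applyMark_ne_le μ₁ μ₂ hR (hA z hz)) φ t).trans_eq ?_
    rw [← ENNReal.ofReal_mul' (by positivity)]
    congr 1
    field_simp

end Graphical

/-! ### Locality of the contour -/

lemma infDist_le_of_forall_dist_lt {α : Type*} [PseudoMetricSpace α] {s t : Set α} {x : α} {r : ℝ}
    (h : ∀ z ∈ s, dist x z < r → z ∈ t) (hs : s.Nonempty) (hr : Metric.infDist x s < r) :
    Metric.infDist x t ≤ Metric.infDist x s := by
  refine le_of_forall_gt fun c hc => ?_
  obtain ⟨z, hz, hzc⟩ := (Metric.infDist_lt_iff hs).1 (lt_min hc hr)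
  exact (Metric.infDist_le_dist_of_mem (h z hz (hzc.trans_le (min_le_right _ _)))).trans_lt
    (hzc.trans_le (min_le_left _ _))

lemma infDist_eq_of_forall_dist_lt {α : Type*} [PseudoMetricSpace α] {s t : Set α} {x : α} {r : ℝ}
    (h : ∀ z, dist x z < r → (z ∈ s ↔ z ∈ t)) (hs : s.Nonempty) (hr : Metric.infDist x s < r) :
    Metric.infDist x t = Metric.infDist x s := by
  have h1 := infDist_le_of_forall_dist_lt (fun z hz hd => (h z hd).1 hz) hs hr
  obtain ⟨z, hz, hd⟩ := (Metric.infDist_lt_iff hs).1 hr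
  exact h1.antisymm (infDist_le_of_forall_dist_lt (fun z hz hd => (h z hd).2 hz)
    ⟨z, (h z hd).1 hz⟩ (h1.trans_lt hr))

lemma abs_sub_apply_le_dist (x y : EuclideanSpace ℝ (Fin 2)) (i : Fin 2) :
    |x i - y i| ≤ dist x y := by
  rw [dist_eq_norm]
  exact PiLp.norm_apply_le (x - y) i

@[simp] lemma dualPoint_zero (p : ℤ × ℤ) : dualPoint p 0 = p.1 + 1 / 2 := rfl

@[simp] lemma dualPoint_one (p : ℤ × ℤ) : dualPoint p 1 = p.2 + 1 / 2 := rfl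

lemma one_div_sqrt_two_lt_one : 1 / Real.sqrt 2 < 1 := by
  rw [div_lt_one (by positivity)]
  exact Real.lt_sqrt_of_sq_lt (by norm_num)

section Contour

variable {L : ℕ}

lemma contour_nonempty (hL : 0 < L) (φ : Config L) : (contour φ).Nonempty := by
  refine ⟨!₂[1 / 2, (φ ⟨0, hL⟩ : ℝ)], Or.inl ⟨⟨0, hL⟩, ?_, rfl⟩⟩
  simp only [mem_Ioo]
  norm_num

lemma infDist_lt_one_of_mem_attached {φ : Config L} {p : ℤ × ℤ} (hp : p ∈ attached φ) :
    Metric.infDist (dualPoint p) (contour φ) < 1 := by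
  rcases hp with h | h
  · rw [h]; norm_num
  · rw [h]; exact one_div_sqrt_two_lt_one

/-- Away from the window of width `1` and height `2` centred at the height `h` over the site `k`, the
contour does not depend on the value at `k`, if it is within distance `1` of `h`. -/
lemma mem_contour_of_eq_off {φ ψ : Config L} {k : Fin L} {h : ℤ} (hoff : ∀ i ≠ k, ψ i = φ i)
    (hφ : |φ k - h| ≤ 1) (hψ : |ψ k - h| ≤ 1) {z : EuclideanSpace ℝ (Fin 2)}
    (hz : ¬ (z 0 ∈ Icc ((k : ℕ) : ℝ) ((k : ℕ) + 1) ∧ |z 1 - h| ≤ 1)) (hzφ : z ∈ contour φ) :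
    z ∈ contour ψ := by
  have hφ' : |(φ k : ℝ) - h| ≤ 1 := by exact_mod_cast hφ
  have hψ' : |(ψ k : ℝ) - h| ≤ 1 := by exact_mod_cast hψ
  rw [abs_le] at hφ' hψ'
  rcases hzφ with ⟨i, h0, h1⟩ | ⟨i, j, hij, h0, h1⟩
  · by_cases hik : i = k
    · subst hik
      refine absurd ⟨⟨h0.1.le, h0.2.le⟩, ?_⟩ hz
      rw [h1, abs_le]
      exact hφ'
    · exact Or.inl ⟨i, h0, by rw [hoff i hik]; exact h1⟩
  · right
    refine ⟨i, j, hij, h0, ?_⟩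
    have hij' : ((j : ℕ) : ℝ) = (i : ℕ) + 1 := by exact_mod_cast hij
    by_cases hik : i = k
    · subst hik
      have hjk : j ≠ i := fun h => by rw [h] at hij; omega
      have hz1 : ¬ |z 1 - h| ≤ 1 := fun hz1 =>
        hz ⟨⟨by rw [h0, hij']; linarith, by rw [h0, hij']⟩, hz1⟩
      rw [hoff j hjk]
      simp only [mem_Icc, min_le_iff, le_max_iff] at h1 ⊢
      rw [abs_le, not_and_or, not_le, not_le] at hz1
      rcases hz1 with hz1 | hz1 <;> rcases h1 with ⟨h1 | h1, h2 | h2⟩ <;>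
        first
        | (exfalso; linarith)
        | (constructor <;> first | exact Or.inl (by linarith) | exact Or.inr (by linarith))
    · rw [hoff i hik]
      by_cases hjk : j = k
      · subst hjk
        have hz1 : ¬ |z 1 - h| ≤ 1 := fun hz1 =>
          hz ⟨⟨h0.ge, by rw [h0]; linarith⟩, hz1⟩
        simp only [mem_Icc, min_le_iff, le_max_iff] at h1 ⊢
        rw [abs_le, not_and_or, not_le, not_le] at hz1
        rcases hz1 with hz1 | hz1 <;> rcases h1 with ⟨h1 | h1, h2 | h2⟩ <;>
          first
          | (exfalso; linarith)
          | (constructor <;> first | exact Or.inl (by linarith) | exact Or.inr (by linarith))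
      · rw [hoff j hjk]
        exact h1

/-- The twelve dual sites whose attachment to the contour may change when the height at `k` changes
by one unit. -/
def nearSites (φ : Config L) (k : Fin L) : Finset (ℤ × ℤ) :=
  Finset.Icc ((k : ℕ) - 1 : ℤ) ((k : ℕ) + 1) ×ˢ Finset.Icc (φ k - 2) (φ k + 1)

lemma card_nearSites (φ : Config L) (k : Fin L) : (nearSites φ k).card = 12 := by
  rw [nearSites, Finset.card_product, Int.card_Icc, Int.card_Icc]
  have h1 : ((k : ℕ) + 1 + 1 - ((k : ℕ) - 1) : ℤ) = 3 := by ring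
  have h2 : φ k + 1 + 1 - (φ k - 2) = 4 := by ring
  rw [h1, h2]
  rfl

lemma move_apply_of_ne (j : Fin L × Bool) {i : Fin L} (hi : i ≠ j.1) :
    (move j : Config L) i = 0 := by
  unfold move
  split_ifs <;> simp [hi]

lemma abs_move_apply_self (j : Fin L × Bool) : |(move j : Config L) j.1| = 1 := by
  unfold move
  split_ifs <;> simp

/-- An attached site is at distance less than `1` from the contour, so whether it is attached depends
only on the contour within distance `1` of it. -/
lemma mem_attached_add_move_iff (hL : 0 < L) (φ : Config L) (j : Fin L × Bool) {p : ℤ × ℤ}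
    (hp : p ∉ nearSites φ j.1) : p ∈ attached (φ + move j) ↔ p ∈ attached φ := by
  set ψ := φ + move j with hψ
  have hoff : ∀ i ≠ j.1, ψ i = φ i := fun i hi => by
    rw [hψ, Pi.add_apply, move_apply_of_ne j hi, add_zero]
  have hk : |ψ j.1 - φ j.1| ≤ 1 := by
    rw [hψ, Pi.add_apply, add_sub_cancel_left, abs_move_apply_self]
  have hk' : |φ j.1 - φ j.1| ≤ 1 := by simp
  have hloc : ∀ z, dist (dualPoint p) z < 1 → (z ∈ contour φ ↔ z ∈ contour ψ) := by
    intro z hz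
    have h0 := (abs_sub_apply_le_dist (dualPoint p) z 0).trans_lt hz
    have h1 := (abs_sub_apply_le_dist (dualPoint p) z 1).trans_lt hz
    rw [dualPoint_zero, abs_lt] at h0
    rw [dualPoint_one, abs_lt] at h1
    have hout : ¬ (z 0 ∈ Icc ((j.1 : ℕ) : ℝ) ((j.1 : ℕ) + 1) ∧ |z 1 - φ j.1| ≤ 1) := by
      rintro ⟨⟨h2, h3⟩, h4⟩
      rw [abs_le] at h4
      refine hp (Finset.mem_product.2 ⟨Finset.mem_Icc.2 ⟨?_, ?_⟩, Finset.mem_Icc.2 ⟨?_, ?_⟩⟩)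
      · have : (((j.1 : ℕ) : ℤ) : ℝ) < ((p.1 + 2 : ℤ) : ℝ) := by push_cast; linarith
        have := Int.cast_lt.1 this; omega
      · have : ((p.1 : ℤ) : ℝ) < ((((j.1 : ℕ) : ℤ) + 2 : ℤ) : ℝ) := by push_cast; linarith
        have := Int.cast_lt.1 this; omega
      · have : ((φ j.1 : ℤ) : ℝ) < ((p.2 + 3 : ℤ) : ℝ) := by push_cast; linarith
        have := Int.cast_lt.1 this; omega
      · have : ((p.2 : ℤ) : ℝ) < ((φ j.1 + 2 : ℤ) : ℝ) := by push_cast; linarith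
        have := Int.cast_lt.1 this; omega
    exact ⟨mem_contour_of_eq_off hoff hk' hk hout,
      mem_contour_of_eq_off (fun i hi => (hoff i hi).symm) hk hk' hout⟩
  constructor
  · intro h
    have := infDist_eq_of_forall_dist_lt (fun z hz => (hloc z hz).symm) (contour_nonempty hL ψ)
      (infDist_lt_one_of_mem_attached h)
    rw [attached, mem_ofPred_eq, this]
    exact h
  · intro h
    have := infDist_eq_of_forall_dist_lt hloc (contour_nonempty hL φ)
      (infDist_lt_one_of_mem_attached h)
    rw [attached, mem_ofPred_eq, this]
    exact h

lemma finite_attached (hL : 0 < L) (φ : Config L) : (attached φ).Finite := by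
  set B : ℤ := ∑ i, |φ i|
  have hB : ∀ i, |(φ i : ℝ)| ≤ B := fun i => by
    have : |φ i| ≤ B := Finset.single_le_sum (f := fun i => |φ i|) (fun i _ => abs_nonneg _)
      (Finset.mem_univ i)
    exact_mod_cast this
  refine ((Finset.Icc (-2 : ℤ) (L + 2) ×ˢ Finset.Icc (-B - 2) (B + 2)).finite_toSet).subset ?_
  intro p hp
  obtain ⟨z, hz, hd⟩ := (Metric.infDist_lt_iff (contour_nonempty hL φ)).1
    (infDist_lt_one_of_mem_attached hp)
  have h0 := (abs_sub_apply_le_dist (dualPoint p) z 0).trans_lt hd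
  have h1 := (abs_sub_apply_le_dist (dualPoint p) z 1).trans_lt hd
  rw [dualPoint_zero, abs_lt] at h0
  rw [dualPoint_one, abs_lt] at h1
  have hbd : (0 ≤ z 0 ∧ z 0 ≤ L) ∧ (-B ≤ z 1 ∧ z 1 ≤ B) := by
    rcases hz with ⟨i, h2, h3⟩ | ⟨i, j, -, h2, h3⟩
    · have hi : ((i : ℕ) : ℝ) + 1 ≤ L := by exact_mod_cast i.2
      have hi0 : (0 : ℝ) ≤ (i : ℕ) := Nat.cast_nonneg _
      have := abs_le.1 (hB i)
      rw [h3]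
      exact ⟨⟨by linarith [h2.1], by linarith [h2.2]⟩, this⟩
    · have hj : ((j : ℕ) : ℝ) ≤ L := by exact_mod_cast j.2.le
      have hj0 : (0 : ℝ) ≤ (j : ℕ) := Nat.cast_nonneg _
      have hi' := abs_le.1 (hB i)
      have hj' := abs_le.1 (hB j)
      rw [h2]
      exact ⟨⟨hj0, hj⟩, (le_min hi'.1 hj'.1).trans h3.1, h3.2.trans (max_le hi'.2 hj'.2)⟩
  obtain ⟨⟨h2, h3⟩, h4, h5⟩ := hbd
  simp only [Finset.coe_product, Finset.coe_Icc, mem_prod, mem_Icc]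
  refine ⟨⟨?_, ?_⟩, ?_, ?_⟩
  · have : ((-2 : ℤ) : ℝ) ≤ p.1 := by push_cast; linarith
    exact_mod_cast this
  · have : (p.1 : ℝ) ≤ ((L + 2 : ℤ) : ℝ) := by push_cast; linarith
    exact_mod_cast this
  · have : ((-B - 2 : ℤ) : ℝ) ≤ p.2 := by push_cast; linarith
    exact_mod_cast this
  · have : (p.2 : ℝ) ≤ ((B + 2 : ℤ) : ℝ) := by push_cast; linarith
    exact_mod_cast this

end Contour

/-! ### Diameters of sets of dual sites -/

lemma dist_dualPoint_le_diam {Λ : Finset (ℤ × ℤ)} {p q : ℤ × ℤ} (hp : p ∈ Λ) (hq : q ∈ Λ) :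
    dist (dualPoint p) (dualPoint q) ≤ diam Λ :=
  Metric.dist_le_diam_of_mem ((Λ.finite_toSet.image dualPoint).isBounded)
    (mem_image_of_mem _ hp) (mem_image_of_mem _ hq)

lemma one_le_dist_dualPoint {p q : ℤ × ℤ} (h : p ≠ q) :
    1 ≤ dist (dualPoint p) (dualPoint q) := by
  by_cases h1 : p.1 = q.1
  · have h2 : p.2 - q.2 ≠ 0 := fun h2 => h (Prod.ext h1 (sub_eq_zero.1 h2))
    have h3 : (1 : ℝ) ≤ |(p.2 : ℝ) - q.2| := by exact_mod_cast Int.one_le_abs h2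
    have := abs_sub_apply_le_dist (dualPoint p) (dualPoint q) 1
    rw [dualPoint_one, dualPoint_one, add_sub_add_right_eq_sub] at this
    exact h3.trans this
  · have h3 : (1 : ℝ) ≤ |(p.1 : ℝ) - q.1| := by
      exact_mod_cast Int.one_le_abs (sub_ne_zero.2 h1)
    have := abs_sub_apply_le_dist (dualPoint p) (dualPoint q) 0
    rw [dualPoint_zero, dualPoint_zero, add_sub_add_right_eq_sub] at this
    exact h3.trans this

lemma eq_singleton_or_one_le_diam {Λ : Finset (ℤ × ℤ)} {p : ℤ × ℤ} (hp : p ∈ Λ) :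
    Λ = {p} ∨ 1 ≤ diam Λ := by
  by_cases h : ∃ q ∈ Λ, q ≠ p
  · obtain ⟨q, hq, hne⟩ := h
    exact Or.inr ((one_le_dist_dualPoint hne).trans (dist_dualPoint_le_diam hq hp))
  · push Not at h
    exact Or.inl (Finset.eq_singleton_iff_unique_mem.2 ⟨hp, h⟩)

/-- A set of dual sites of the strip that leaves the box of half-height `L / 2`, and contains a site
near a point of the contour at height at most `(1 - ε) L / 2`, is large. -/
lemma le_diam_of_not_subset_box {L : ℕ} {ε : ℝ} {φ : Config L} {k : Fin L}
    (hφ : |(φ k : ℝ)| ≤ (1 - ε) * L / 2) {Λ : Finset (ℤ × ℤ)} (hs : (Λ : Set (ℤ × ℤ)) ⊆ strip L)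
    (hb : ¬ (Λ : Set (ℤ × ℤ)) ⊆ box L (L / 2)) {p : ℤ × ℤ} (hp : p ∈ Λ)
    (hpn : p ∈ nearSites φ k) : ε * L / 2 - 1 ≤ diam Λ := by
  obtain ⟨q, hq, hqb⟩ := not_subset.1 hb
  have hq1 : ¬ dualPoint q 1 ∈ Icc (-((L : ℝ) / 2 + 1 / 2)) (L / 2 + 1 / 2) :=
    fun h => hqb ⟨hs hq, h⟩
  have hd := (abs_sub_apply_le_dist (dualPoint p) (dualPoint q) 1).trans
    (dist_dualPoint_le_diam hp hq)
  rw [dualPoint_one] at hq1 hd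
  rw [dualPoint_one] at hd
  have hp2 := Finset.mem_Icc.1 (Finset.mem_product.1 hpn).2
  have h1 : (φ k : ℝ) - 2 ≤ p.2 := by exact_mod_cast hp2.1
  have h2 : (p.2 : ℝ) ≤ φ k + 1 := by exact_mod_cast hp2.2
  rw [abs_le] at hφ hd
  rw [mem_Icc, not_and_or, not_le, not_le] at hq1
  rcases hq1 with h | h
  · linarith
  · linarith

/-! ### The long range interaction -/

lemma tsum_subtype_eq_tsum_ite {α M : Type*} [AddCommMonoid M] [TopologicalSpace M] (p : α → Prop)
    [DecidablePred p] (f : α → M) : ∑' x : {x // p x}, f x = ∑' x, if p x then f x else 0 := by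
  have hsupp : Function.support (fun x => if p x then f x else 0)
      ⊆ range (Subtype.val : {x // p x} → α) := by
    intro x hx
    rw [Subtype.range_coe_subtype]
    by_contra h
    exact hx (if_neg h)
  rw [← Subtype.val_injective.tsum_eq hsupp]
  exact tsum_congr fun x => (if_pos x.2).symm

/-- The bound `|Φ(β, {0})| + exp (-m(β))` for the sum of `|Φ(β, Λ)|` over the connected `Λ`
containing a given site. The decay assumption says nothing about the one-point sets, which have
diameter `0`. -/
def siteBound (Φ : ℝ → Finset (ℤ × ℤ) → ℝ) (m : ℝ → ℝ) (β : ℝ) : ℝ :=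
  |Φ β {0}| + Real.exp (-m β)

lemma siteBound_nonneg (Φ : ℝ → Finset (ℤ × ℤ) → ℝ) (m : ℝ → ℝ) (β : ℝ) :
    0 ≤ siteBound Φ m β := by
  unfold siteBound; positivity

section Sums

open Classical

variable {Φ : ℝ → Finset (ℤ × ℤ) → ℝ} {β : ℝ}

/-- A sum over the connected sets that meet a finite set `N` of sites is controlled by the sums over
the connected sets containing a given site of `N`. -/
lemma summable_and_abs_tsum_le {e : Finset (ℤ × ℤ) → ℝ} (N : Finset (ℤ × ℤ))
    (Q : Finset (ℤ × ℤ) → Prop) [DecidablePred Q] {b : ℝ} (hb : 0 ≤ b)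
    (hN : ∀ p ∈ N, ∑' Λ : Finset (ℤ × ℤ),
      (if IsConn Λ ∧ p ∈ Λ ∧ Q Λ then ENNReal.ofReal |Φ β Λ| else 0) ≤ ENNReal.ofReal b)
    (he : ∀ Λ, |e Λ| ≤ if IsConn Λ ∧ Q Λ ∧ ∃ p ∈ N, p ∈ Λ then |Φ β Λ| else 0) :
    Summable e ∧ |∑' Λ, e Λ| ≤ N.card * b := by
  have hsum : ∑' Λ, ENNReal.ofReal |e Λ| ≤ ENNReal.ofReal (N.card * b) := by
    calc ∑' Λ, ENNReal.ofReal |e Λ|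
        ≤ ∑' Λ, ∑ p ∈ N, (if IsConn Λ ∧ p ∈ Λ ∧ Q Λ then ENNReal.ofReal |Φ β Λ| else 0) := by
          refine ENNReal.tsum_le_tsum fun Λ => ?_
          refine (ENNReal.ofReal_le_ofReal (he Λ)).trans ?_
          split_ifs with h
          · obtain ⟨h1, h2, p, hp, hpΛ⟩ := h
            refine le_trans ?_ (Finset.single_le_sum (f := fun p =>
              if IsConn Λ ∧ p ∈ Λ ∧ Q Λ then ENNReal.ofReal |Φ β Λ| else 0)
              (fun _ _ => zero_le) hp)
            rw [if_pos ⟨h1, hpΛ, h2⟩]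
          · simp
      _ = ∑ p ∈ N, ∑' Λ, (if IsConn Λ ∧ p ∈ Λ ∧ Q Λ then ENNReal.ofReal |Φ β Λ| else 0) :=
          Summable.tsum_finsetSum fun _ _ => ENNReal.summable
      _ ≤ ∑ p ∈ N, ENNReal.ofReal b := Finset.sum_le_sum hN
      _ = ENNReal.ofReal (N.card * b) := by
          rw [Finset.sum_const, nsmul_eq_mul, ENNReal.ofReal_mul (Nat.cast_nonneg _),
            ENNReal.ofReal_natCast]
  have hne : ∑' Λ, ENNReal.ofReal |e Λ| ≠ ⊤ := (hsum.trans_lt ENNReal.ofReal_lt_top).ne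
  have habs : Summable fun Λ => |e Λ| := by
    simpa using ENNReal.summable_toReal hne
  refine ⟨habs.of_abs, ?_⟩
  calc |∑' Λ, e Λ| ≤ ∑' Λ, |e Λ| := by
        simpa using norm_tsum_le_tsum_norm (f := e) (by simpa using habs)
    _ = (∑' Λ, ENNReal.ofReal |e Λ|).toReal := by
        rw [ENNReal.tsum_toReal_eq fun _ => ENNReal.ofReal_ne_top]
        simp
    _ ≤ N.card * b := ENNReal.toReal_le_of_le_ofReal (by positivity) hsum

/-- The contribution of `Λ` to the long range interaction in `V`. -/
def interactionTerm (Φ : ℝ → Finset (ℤ × ℤ) → ℝ) (β : ℝ) {L : ℕ} (V : Set (ℤ × ℤ)) (φ : Config L)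
    (Λ : Finset (ℤ × ℤ)) : ℝ :=
  if IsConn Λ ∧ (Λ : Set (ℤ × ℤ)) ⊆ V ∧ ((Λ : Set (ℤ × ℤ)) ∩ attached φ).Nonempty then Φ β Λ
  else 0

lemma longRange_eq_tsum {L : ℕ} (V : Set (ℤ × ℤ)) (φ : Config L) :
    longRange Φ β V φ = ∑' Λ, interactionTerm Φ β V φ Λ :=
  tsum_subtype_eq_tsum_ite _ _

lemma inter_attached_add_move_nonempty_iff {L : ℕ} (hL : 0 < L) (φ : Config L) (j : Fin L × Bool)
    {Λ : Finset (ℤ × ℤ)} (h : ∀ p ∈ nearSites φ j.1, p ∉ Λ) :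
    ((Λ : Set (ℤ × ℤ)) ∩ attached (φ + move j)).Nonempty
      ↔ ((Λ : Set (ℤ × ℤ)) ∩ attached φ).Nonempty :=
  exists_congr fun p => and_congr_right fun hp =>
    mem_attached_add_move_iff hL φ j fun hpn => h p hpn hp

variable {m : ℝ → ℝ} {β₀ : ℝ} (hΦ : IsPotential Φ m β₀) (hβ : β₀ < β)
include hΦ hβ

lemma tsum_mem_le_diam_le {k : ℝ} (hk : 0 < k) (p : ℤ × ℤ) :
    ∑' Λ : Finset (ℤ × ℤ), (if IsConn Λ ∧ p ∈ Λ ∧ k ≤ diam Λ then ENNReal.ofReal |Φ β Λ| else 0)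
      ≤ ENNReal.ofReal (Real.exp (-(m β * k))) := by
  rw [← tsum_subtype_eq_tsum_ite]
  exact hΦ.decay β hβ k hk p

lemma tsum_mem_le (p : ℤ × ℤ) :
    ∑' Λ : Finset (ℤ × ℤ), (if IsConn Λ ∧ p ∈ Λ ∧ True then ENNReal.ofReal |Φ β Λ| else 0)
      ≤ ENNReal.ofReal (siteBound Φ m β) := by
  have hp : Φ β {p} = Φ β {0} := by
    have := hΦ.translation β hβ p {0}
    simpa using this
  calc _ ≤ ∑' Λ : Finset (ℤ × ℤ), ((if Λ = {p} then ENNReal.ofReal |Φ β {0}| else 0) +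
        if IsConn Λ ∧ p ∈ Λ ∧ 1 ≤ diam Λ then ENNReal.ofReal |Φ β Λ| else 0) := by
        refine ENNReal.tsum_le_tsum fun Λ => ?_
        by_cases h : IsConn Λ ∧ p ∈ Λ
        · rw [if_pos ⟨h.1, h.2, trivial⟩]
          rcases eq_singleton_or_one_le_diam h.2 with h1 | h1
          · rw [if_pos h1, h1, hp]
            exact le_self_add
          · rw [if_pos (c := IsConn Λ ∧ p ∈ Λ ∧ 1 ≤ diam Λ) ⟨h.1, h.2, h1⟩]
            exact le_add_self
        · rw [if_neg fun h' => h ⟨h'.1, h'.2.1⟩]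
          exact zero_le
    _ ≤ ENNReal.ofReal |Φ β {0}| + ENNReal.ofReal (Real.exp (-(m β * 1))) := by
        rw [ENNReal.tsum_add, tsum_ite_eq]
        gcongr
        exact tsum_mem_le_diam_le hΦ hβ one_pos p
    _ = _ := by
        rw [mul_one, ← ENNReal.ofReal_add (abs_nonneg _) (Real.exp_nonneg _)]
        rfl

lemma summable_interactionTerm {L : ℕ} (hL : 0 < L) (V : Set (ℤ × ℤ)) (φ : Config L) :
    Summable (interactionTerm Φ β V φ) := by
  refine (summable_and_abs_tsum_le (Φ := Φ) (β := β) (finite_attached hL φ).toFinset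
    (fun _ => True) (siteBound_nonneg Φ m β) (fun p _ => tsum_mem_le hΦ hβ p) fun Λ => ?_).1
  unfold interactionTerm
  by_cases h : IsConn Λ ∧ (Λ : Set (ℤ × ℤ)) ⊆ V ∧ ((Λ : Set (ℤ × ℤ)) ∩ attached φ).Nonempty
  · obtain ⟨p, hp, hpφ⟩ := h.2.2
    rw [if_pos h, if_pos ⟨h.1, trivial, p, by simpa using hpφ, hp⟩]
  · rw [if_neg h, abs_zero]
    split_ifs
    exacts [abs_nonneg _, le_rfl]

/-- Only the connected sets containing one of the twelve sites of `nearSites` contribute to the change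
of the long range interaction. -/
lemma abs_longRange_sub_le {L : ℕ} (hL : 0 < L) (V : Set (ℤ × ℤ)) (φ : Config L)
    (j : Fin L × Bool) :
    |longRange Φ β V (φ + move j) - longRange Φ β V φ| ≤ 12 * siteBound Φ m β := by
  have hs := fun ψ : Config L => summable_interactionTerm hΦ hβ hL V ψ
  rw [longRange_eq_tsum, longRange_eq_tsum, ← (hs _).tsum_sub (hs _)]
  have := (summable_and_abs_tsum_le (Φ := Φ) (β := β) (nearSites φ j.1) (fun _ => True)
    (siteBound_nonneg Φ m β) (fun p _ => tsum_mem_le hΦ hβ p)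
    (e := fun Λ => interactionTerm Φ β V (φ + move j) Λ - interactionTerm Φ β V φ Λ)
    fun Λ => ?_).2
  · rwa [card_nearSites, Nat.cast_ofNat] at this
  by_cases hn : ∀ p ∈ nearSites φ j.1, p ∉ Λ
  · rw [interactionTerm, interactionTerm, inter_attached_add_move_nonempty_iff hL φ j hn, sub_self,
      abs_zero]
    split_ifs
    exacts [abs_nonneg _, le_rfl]
  · push Not at hn
    by_cases hc : IsConn Λ
    · rw [if_pos ⟨hc, trivial, hn⟩]
      unfold interactionTerm
      split_ifs <;> simp
    · simp [interactionTerm, hc]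

/-- Deep inside the box, the cost of a move is the same in the box and in the strip, up to the
contribution of the sets which reach from the site of the move to the outside of the box. -/
lemma abs_longRange_strip_sub_box_le {L : ℕ} (hL : 0 < L) {ε : ℝ} (hε : 4 ≤ ε * L) {φ : Config L}
    {j : Fin L × Bool} (hφ : |(φ j.1 : ℝ)| ≤ (1 - ε) * L / 2) :
    |(longRange Φ β (box L (L / 2)) (φ + move j) - longRange Φ β (box L (L / 2)) φ)
      - (longRange Φ β (strip L) (φ + move j) - longRange Φ β (strip L) φ)|
        ≤ 12 * Real.exp (-(m β / 4 * ε * L)) := by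
  have hs := fun (V : Set (ℤ × ℤ)) (ψ : Config L) => summable_interactionTerm hΦ hβ hL V ψ
  simp_rw [longRange_eq_tsum]
  rw [← (hs _ _).tsum_sub (hs _ _), ← (hs _ _).tsum_sub (hs _ _),
    ← ((hs _ _).sub (hs _ _)).tsum_sub ((hs _ _).sub (hs _ _))]
  have hdecay : ∀ p ∈ nearSites φ j.1, ∑' Λ : Finset (ℤ × ℤ),
      (if IsConn Λ ∧ p ∈ Λ ∧ ε * L / 4 ≤ diam Λ then ENNReal.ofReal |Φ β Λ| else 0)
        ≤ ENNReal.ofReal (Real.exp (-(m β / 4 * ε * L))) := fun p _ => by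
    refine (tsum_mem_le_diam_le hΦ hβ (by linarith) p).trans_eq ?_
    congr 3; ring
  have := (summable_and_abs_tsum_le (Φ := Φ) (β := β) (nearSites φ j.1)
    (fun Λ => ε * L / 4 ≤ diam Λ) (Real.exp_nonneg _) hdecay
    (e := fun Λ => (interactionTerm Φ β (box L (L / 2)) (φ + move j) Λ
      - interactionTerm Φ β (box L (L / 2)) φ Λ)
      - (interactionTerm Φ β (strip L) (φ + move j) Λ - interactionTerm Φ β (strip L) φ Λ))
    fun Λ => ?_).2
  · rwa [card_nearSites, Nat.cast_ofNat] at this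
  have hbs : box L (L / 2) ⊆ strip L := fun p hp => hp.1
  have hnn : 0 ≤ if IsConn Λ ∧ ε * L / 4 ≤ diam Λ ∧ ∃ p ∈ nearSites φ j.1, p ∈ Λ then |Φ β Λ|
      else 0 := by
    split_ifs
    exacts [abs_nonneg _, le_rfl]
  by_cases hn : ∀ p ∈ nearSites φ j.1, p ∉ Λ
  · simp only [interactionTerm, inter_attached_add_move_nonempty_iff hL φ j hn, sub_self, abs_zero]
    exact hnn
  push Not at hn
  by_cases hc : IsConn Λ
  swap
  · simp [interactionTerm, hc]
  by_cases hb : (Λ : Set (ℤ × ℤ)) ⊆ box L (L / 2)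
  · simpa [interactionTerm, hb, hb.trans hbs] using hnn
  by_cases hst : (Λ : Set (ℤ × ℤ)) ⊆ strip L
  swap
  · simpa [interactionTerm, hb, hst] using hnn
  obtain ⟨p, hpn, hpΛ⟩ := hn
  have hd := le_diam_of_not_subset_box hφ hst hb hpΛ hpn
  rw [if_pos ⟨hc, by linarith, p, hpn, hpΛ⟩]
  simp only [interactionTerm, hc, hb, hst, true_and, false_and, and_false, if_false, sub_self,
    zero_sub, abs_neg]
  split_ifs <;> simp

end Sums

/-! ### Jump rates -/

section Rates

variable {L : ℕ}

lemma abs_localEnergy_add_move_sub_le (φ : Config L) (j : Fin L × Bool) :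
    |localEnergy (φ + move j) - localEnergy φ| ≤ 2 := by
  set d : Fin L → ℝ := fun i => |((move j : Config L) i : ℝ)| with hd
  have hd1 : d j.1 = 1 := by
    have := abs_move_apply_self j
    simp only [hd]
    exact_mod_cast this
  have hd0 : ∀ i ≠ j.1, d i = 0 := fun i hi => by simp [hd, move_apply_of_ne j hi]
  have hsum : ∑ i, d i = 1 := by
    rw [Finset.sum_eq_single j.1 (fun i _ hi => hd0 i hi) (by simp), hd1]
  have hdnn : ∀ i, 0 ≤ d i := fun i => abs_nonneg _
  have hrow : ∀ i : Fin L, ∑ i' : Fin L, (if (i' : ℕ) = i + 1 then d i else 0) ≤ d i := by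
    intro i
    rw [← Finset.sum_filter, Finset.sum_const, nsmul_eq_mul]
    have : (Finset.univ.filter fun i' : Fin L => (i' : ℕ) = i + 1).card ≤ 1 :=
      Finset.card_le_one.2 fun a ha b hb => Fin.ext (by simp at ha hb; omega)
    have h1 : ((Finset.univ.filter fun i' : Fin L => (i' : ℕ) = i + 1).card : ℝ) ≤ 1 := by
      exact_mod_cast this
    nlinarith [hdnn i]
  have hcol : ∀ i' : Fin L, ∑ i : Fin L, (if (i' : ℕ) = i + 1 then d i' else 0) ≤ d i' := by
    intro i'
    rw [← Finset.sum_filter, Finset.sum_const, nsmul_eq_mul]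
    have : (Finset.univ.filter fun i : Fin L => (i' : ℕ) = i + 1).card ≤ 1 :=
      Finset.card_le_one.2 fun a ha b hb => Fin.ext (by simp at ha hb; omega)
    have h1 : ((Finset.univ.filter fun i : Fin L => (i' : ℕ) = i + 1).card : ℝ) ≤ 1 := by
      exact_mod_cast this
    nlinarith [hdnn i']
  have hterm : ∀ i i' : Fin L,
      |(if (i' : ℕ) = i + 1 then |((φ + move j) i' : ℝ) - ((φ + move j) i : ℤ)| else 0)
        - (if (i' : ℕ) = i + 1 then |(φ i' : ℝ) - φ i| else 0)|
      ≤ (if (i' : ℕ) = i + 1 then d i' else 0) + (if (i' : ℕ) = i + 1 then d i else 0) := by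
    intro i i'
    split_ifs
    · refine (abs_abs_sub_abs_le_abs_sub _ _).trans ?_
      have : ((φ + move j) i' : ℝ) - ((φ + move j) i : ℤ) - ((φ i' : ℝ) - φ i)
          = ((move j : Config L) i' : ℝ) - ((move j : Config L) i : ℝ) := by
        simp only [Pi.add_apply]; push_cast; ring
      rw [this]
      exact abs_sub _ _
    · simp
  unfold localEnergy
  rw [← Finset.sum_sub_distrib]
  simp_rw [← Finset.sum_sub_distrib]
  calc _ ≤ ∑ i : Fin L, ∑ i' : Fin L, ((if (i' : ℕ) = i + 1 then d i' else 0)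
        + (if (i' : ℕ) = i + 1 then d i else 0)) :=
        (Finset.abs_sum_le_sum_abs _ _).trans (Finset.sum_le_sum fun i _ =>
          (Finset.abs_sum_le_sum_abs _ _).trans (Finset.sum_le_sum fun i' _ => hterm i i'))
    _ = (∑ i' : Fin L, ∑ i : Fin L, (if (i' : ℕ) = i + 1 then d i' else 0))
        + ∑ i : Fin L, ∑ i' : Fin L, (if (i' : ℕ) = i + 1 then d i else 0) := by
        simp_rw [Finset.sum_add_distrib]
        rw [Finset.sum_comm]
    _ ≤ ∑ i', d i' + ∑ i, d i :=
        add_le_add (Finset.sum_le_sum fun i' _ => hcol i') (Finset.sum_le_sum fun i _ => hrow i)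
    _ = 2 := by rw [hsum]; norm_num

open Classical in
/-- The jump rates do not depend on the normalization of the measure. -/
lemma jumpRate_gibbs {w : Config L → ℝ} {c : Config L → Prop} {E : Config L → ℝ}
    (hw : ∀ φ, c φ → w φ = Real.exp (E φ)) (hw0 : ∀ φ, ¬ c φ → w φ = 0) (hc : ∃ φ, c φ)
    (φ ψ : Config L) :
    jumpRate (gibbs w) φ ψ
      = if c φ ∧ c ψ ∧ IsMove φ ψ then Real.exp ((E ψ - E φ) / 2) else 0 := by
  have hnn : ∀ φ, 0 ≤ w φ := fun φ => by
    by_cases h : c φ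
    · rw [hw φ h]; exact Real.exp_nonneg _
    · rw [hw0 φ h]
  have hZ : 0 < partitionFunction w := by
    unfold partitionFunction
    split_ifs with hs
    · obtain ⟨φ, hφ⟩ := hc
      exact hs.tsum_pos hnn φ (by rw [hw φ hφ]; exact Real.exp_pos _)
    · exact one_pos
  unfold jumpRate gibbs
  by_cases hφ : c φ
  · have hpos : 0 < w φ / partitionFunction w := by
      rw [hw φ hφ]; exact div_pos (Real.exp_pos _) hZ
    by_cases hm : IsMove φ ψ
    · rw [if_pos ⟨hpos, hm⟩, div_div_div_cancel_right₀ hZ.ne']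
      by_cases hψ : c ψ
      · rw [if_pos ⟨hφ, hψ, hm⟩, hw φ hφ, hw ψ hψ, ← Real.exp_sub, ← Real.exp_half]
      · rw [if_neg fun h => hψ h.2.1, hw0 ψ hψ, zero_div, Real.sqrt_zero]
    · rw [if_neg fun h => hm h.2, if_neg fun h => hm h.2.2]
  · rw [if_neg (c := c φ ∧ c ψ ∧ IsMove φ ψ) fun h => hφ h.1, if_neg]
    rintro ⟨h, -⟩
    rw [hw0 φ hφ, zero_div] at h
    exact lt_irrefl _ h

lemma abs_exp_sub_exp_le {x y c : ℝ} (hx : x ≤ c) (hy : y ≤ c) :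
    |Real.exp x - Real.exp y| ≤ Real.exp c * |x - y| := by
  have key : ∀ x y : ℝ, x ≤ c → y ≤ x → Real.exp x - Real.exp y ≤ Real.exp c * (x - y) := by
    intro x y hx hyx
    have h1 := Real.add_one_le_exp (y - x)
    have h2 : Real.exp y = Real.exp x * Real.exp (y - x) := by rw [← Real.exp_add]; congr 1; ring
    have h3 : Real.exp x - Real.exp y ≤ Real.exp x * (x - y) := by
      rw [h2]; nlinarith [Real.exp_pos x]
    exact h3.trans (mul_le_mul_of_nonneg_right (Real.exp_le_exp.2 hx) (sub_nonneg.2 hyx))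
  rcases le_total y x with h | h
  · rw [abs_of_nonneg (sub_nonneg.2 (Real.exp_le_exp.2 h)), abs_of_nonneg (sub_nonneg.2 h)]
    exact key x y hx h
  · rw [abs_sub_comm, abs_sub_comm x, abs_of_nonneg (sub_nonneg.2 (Real.exp_le_exp.2 h)),
      abs_of_nonneg (sub_nonneg.2 h)]
    exact key y x hy h

/-- The exponent of the Boltzmann weight in the volume `V`. -/
def exponent (Φ : ℝ → Finset (ℤ × ℤ) → ℝ) (β : ℝ) (V : Set (ℤ × ℤ)) (φ : Config L) : ℝ :=
  -(β * localEnergy φ) - longRange Φ β V φ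

/-- An upper bound for all the jump rates. -/
def rateBound (Φ : ℝ → Finset (ℤ × ℤ) → ℝ) (m : ℝ → ℝ) (β : ℝ) : ℝ :=
  Real.exp (β + 6 * siteBound Φ m β)

variable {Φ : ℝ → Finset (ℤ × ℤ) → ℝ} {m : ℝ → ℝ} {β₀ β : ℝ} (hΦ : IsPotential Φ m β₀)
  (hβ : β₀ < β) (hL : 0 < L)
include hΦ hβ hL

lemma half_exponent_sub_le (V : Set (ℤ × ℤ)) (φ : Config L) (j : Fin L × Bool) :
    (exponent Φ β V (φ + move j) - exponent Φ β V φ) / 2 ≤ β + 6 * siteBound Φ m β := by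
  have h1 := abs_le.1 (abs_longRange_sub_le hΦ hβ hL V φ j)
  have h2 := abs_le.1 (abs_localEnergy_add_move_sub_le φ j)
  have h3 : 0 < β := hΦ.threshold_pos.trans hβ
  unfold exponent
  nlinarith [h1.1, h2.1]

lemma jumpRate_gibbs_le {w : Config L → ℝ} {c : Config L → Prop} {V : Set (ℤ × ℤ)}
    (hw : ∀ φ, c φ → w φ = Real.exp (exponent Φ β V φ)) (hw0 : ∀ φ, ¬ c φ → w φ = 0)
    (hc : ∃ φ, c φ) (φ ψ : Config L) : jumpRate (gibbs w) φ ψ ≤ rateBound Φ m β := by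
  rw [jumpRate_gibbs hw hw0 hc]
  split_ifs with h
  · obtain ⟨j, rfl⟩ := isMove_iff.1 h.2.2
    exact Real.exp_le_exp.2 (half_exponent_sub_le hΦ hβ hL V φ j)
  · exact Real.exp_nonneg _

lemma jumpRate_weight_le (φ ψ : Config L) :
    jumpRate (gibbs (weight Φ β ((L : ℝ) / 2))) φ ψ ≤ rateBound Φ m β :=
  jumpRate_gibbs_le hΦ hβ hL (fun _ h => if_pos h) (fun _ h => if_neg h)
    ⟨0, by rw [norm_zero]; positivity⟩ φ ψ

lemma jumpRate_auxWeight_le (φ ψ : Config L) :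
    jumpRate (gibbs (auxWeight Φ β ((L : ℝ) / 2))) φ ψ ≤ rateBound Φ m β :=
  jumpRate_gibbs_le hΦ hβ hL (fun _ h => if_pos h) (fun _ h => if_neg h)
    ⟨0, fun i _ => by rw [Pi.zero_apply, Int.cast_zero, abs_zero]; positivity⟩ φ ψ

/-- In the region `‖φ‖ ≤ (1 - ε) L / 2` the rates of the two dynamics are exponentially close. -/
lemma abs_jumpRate_sub_le {ε : ℝ} {φ : Config L} (hφ : φ ∈ region L ε)
    (j : Fin L × Bool) :
    |jumpRate (gibbs (weight Φ β ((L : ℝ) / 2))) φ (φ + move j)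
      - jumpRate (gibbs (auxWeight Φ β ((L : ℝ) / 2))) φ (φ + move j)|
      ≤ rateBound Φ m β * (6 + Real.exp (m β)) * Real.exp (-(m β / 4 * ε * L)) := by
  have hm : 0 < m β := hΦ.rate_pos β hβ
  have hR : 0 < rateBound Φ m β := Real.exp_pos _
  have hLr : (0 : ℝ) < L := Nat.cast_pos.2 hL
  rcases lt_or_ge (ε * L) 4 with h4 | h4
  · -- if `ε L` is bounded, so is the exponential, and the bound on the rates suffices
    have h1 : 1 ≤ Real.exp (m β) * Real.exp (-(m β / 4 * ε * L)) := by
      rw [← Real.exp_add]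
      refine Real.one_le_exp ?_
      nlinarith
    have h2 := jumpRate_weight_le hΦ hβ hL φ (φ + move j)
    have h3 := jumpRate_auxWeight_le hΦ hβ hL φ (φ + move j)
    have h5 := jumpRate_nonneg (gibbs (weight Φ β ((L : ℝ) / 2))) φ (φ + move j)
    have h6 := jumpRate_nonneg (gibbs (auxWeight Φ β ((L : ℝ) / 2))) φ (φ + move j)
    have h7 : 0 < Real.exp (-(m β / 4 * ε * L)) := Real.exp_pos _
    calc _ ≤ rateBound Φ m β * 1 := by
          rw [abs_le]; constructor <;> linarith
      _ ≤ rateBound Φ m β * (6 * Real.exp (-(m β / 4 * ε * L))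
          + Real.exp (m β) * Real.exp (-(m β / 4 * ε * L))) := by
          gcongr
          linarith
      _ = _ := by ring
  · have hφn : ‖φ‖ ≤ (1 - ε) * L / 2 := hφ
    have hcoord : ∀ (ψ : Config L) (i : Fin L), |(ψ i : ℝ)| ≤ ‖ψ‖ := fun ψ i => by
      rw [← Int.norm_eq_abs]; exact norm_le_pi_norm ψ i
    have hmove : ‖(move j : Config L)‖ ≤ 1 := by
      refine (pi_norm_le_iff_of_nonneg zero_le_one).2 fun i => ?_
      rw [Int.norm_eq_abs]
      by_cases hi : i = j.1
      · subst hi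
        have := abs_move_apply_self j
        exact_mod_cast this.le
      · rw [move_apply_of_ne j hi]; simp
    have hφL : ‖φ‖ ≤ (L : ℝ) / 2 := by linarith
    have hψL : ‖φ + move j‖ ≤ (L : ℝ) / 2 := by
      have := norm_add_le φ (move j)
      linarith
    have hmv : IsMove φ (φ + move j) := isMove_iff.2 ⟨j, rfl⟩
    have h1 : jumpRate (gibbs (weight Φ β ((L : ℝ) / 2))) φ (φ + move j)
        = Real.exp ((exponent Φ β (box L (L / 2)) (φ + move j)
          - exponent Φ β (box L (L / 2)) φ) / 2) := by
      refine (jumpRate_gibbs (c := fun φ => ‖φ‖ ≤ (L : ℝ) / 2)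
        (E := exponent Φ β (box L (L / 2))) (fun _ h => if_pos h) (fun _ h => if_neg h)
        ⟨φ, hφL⟩ φ (φ + move j)).trans ?_
      rw [if_pos ⟨hφL, hψL, hmv⟩]
    have h2 : jumpRate (gibbs (auxWeight Φ β ((L : ℝ) / 2))) φ (φ + move j)
        = Real.exp ((exponent Φ β (strip L) (φ + move j) - exponent Φ β (strip L) φ) / 2) := by
      refine (jumpRate_gibbs
        (c := fun φ => ∀ i : Fin L, (i : ℕ) = 0 → |(φ i : ℝ)| ≤ (L : ℝ) / 2)
        (E := exponent Φ β (strip L)) (fun _ h => if_pos h) (fun _ h => if_neg h) ⟨φ, fun i _ => (hcoord φ i).trans hφL⟩ φ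
          (φ + move j)).trans ?_
      rw [if_pos ⟨fun i _ => (hcoord φ i).trans hφL, fun i _ => (hcoord _ i).trans hψL, hmv⟩]
    have hW := abs_longRange_strip_sub_box_le hΦ hβ hL h4 (j := j) ((hcoord φ j.1).trans hφn)
    rw [h1, h2]
    refine (abs_exp_sub_exp_le (half_exponent_sub_le hΦ hβ hL _ φ j)
      (half_exponent_sub_le hΦ hβ hL _ φ j)).trans ?_
    rw [mul_assoc]
    refine mul_le_mul_of_nonneg_left ?_ hR.le
    have h3 : 0 ≤ Real.exp (m β) * Real.exp (-(m β / 4 * ε * L)) := by positivity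
    have h5 : (exponent Φ β (box L (L / 2)) (φ + move j) - exponent Φ β (box L (L / 2)) φ) / 2
        - (exponent Φ β (strip L) (φ + move j) - exponent Φ β (strip L) φ) / 2
        = -((longRange Φ β (box L (L / 2)) (φ + move j) - longRange Φ β (box L (L / 2)) φ)
          - (longRange Φ β (strip L) (φ + move j) - longRange Φ β (strip L) φ)) / 2 := by
      unfold exponent; ring
    rw [h5, abs_div, abs_neg, abs_two, add_mul]
    linarith

end Rates

end SOS

end

theorem proposition3p1 (Φ : ℝ → Finset (ℤ × ℤ) → ℝ) (m : ℝ → ℝ) (β₀ : ℝ)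
    (hΦ : SOS.IsPotential Φ m β₀) :
    ∃ K₁ K₂ : ℝ → ℝ,
      (∀ β > β₀, 0 < K₁ β ∧ 0 < K₂ β) ∧ Tendsto K₂ atTop atTop ∧
      ∀ β > β₀, ∀ L : ℕ, 0 < L →
        ∃ (Ω : Type) (_ : MeasurableSpace Ω)
          (P : SOS.Config L → SOS.Config L → Measure Ω) (X Y : ℝ≥0 → Ω → SOS.Config L),
          (∀ φ φ' : SOS.Config L,
            IsProbabilityMeasure (P φ φ') ∧
            P φ φ' {ω | X 0 ω = φ ∧ Y 0 ω = φ'} = 1 ∧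
            SOS.IsMarkovProcess (SOS.G Φ β L ((L : ℝ) / 2)) X (P φ φ') ∧
            SOS.IsMarkovProcess (SOS.Gbar Φ β L ((L : ℝ) / 2)) Y (P φ φ')) ∧
          ∀ ε : ℝ, 0 < ε → ε < 1 / 100 → ∀ φ ∈ SOS.region L ε, ∀ t : ℝ≥0,
            P φ φ {ω | SOS.decouplingTime X Y ω ≤ (t : ℝ≥0∞) ∧
                SOS.decouplingTime X Y ω ≤ SOS.exitTime (SOS.region L ε) Y ω}
              ≤ ENNReal.ofReal (K₁ β * L * t * Real.exp (-(K₂ β * ε * L))) := by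
  refine ⟨fun β => 2 * (SOS.rateBound Φ m β * (6 + Real.exp (m β))), fun β => m β / 4,
    fun β hβ => ⟨?_, ?_⟩, hΦ.rate_tendsto.atTop_div_const (by norm_num), fun β hβ L hL => ?_⟩
  · have : 0 < SOS.rateBound Φ m β := Real.exp_pos _
    positivity
  · have := hΦ.rate_pos β hβ
    positivity
  obtain ⟨Ω, mΩ, P, X, Y, hXY, hdec⟩ := SOS.exists_coupling hL
    (SOS.gibbs (SOS.weight Φ β ((L : ℝ) / 2))) (SOS.gibbs (SOS.auxWeight Φ β ((L : ℝ) / 2)))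
    (Real.exp_pos (β + 6 * SOS.siteBound Φ m β)) (SOS.jumpRate_weight_le hΦ hβ hL)
    (SOS.jumpRate_auxWeight_le hΦ hβ hL)
  refine ⟨Ω, mΩ, P, X, Y, hXY, fun ε _ _ φ _ t => ?_⟩
  refine (hdec (SOS.region L ε) _ (fun ψ hψ j => SOS.abs_jumpRate_sub_le hΦ hβ hL hψ j)
    φ t).trans_eq ?_
  congr 1
  ring
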